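/- Let $\mathcal H=\ell^2(\mathbb N,\mathbb C)$ be the single-mode Hilbert space with Fock basis $(|n\rangle)_{n\in\mathbb N}$ and number operator $\hat n=\sum_n n|n\rangle\langle n|$, let $\mathcal H_N=\mathrm{span}\{|0\rangle,\dots,|N\rangle\}$ with orthogonal projector $\Pi_N$, and let $\mathcal S\subset\mathcal H$ be the Schwartz space of all $\sum_n c_n|n\rangle$ with $\lim_{n\to\infty}c_nn^k=0$ for every $k\in\mathbb N$. For a unitary $U$ on $\mathcal H$ and real $x\ge 0$ put $E_U(x)=\sup\{\langle\psi|U^\dagger\hat nU|\psi\rangle:\psi\in\mathcal H_{\lfloor x\rfloor},\ \|\psi\|=1\}$. For a difference $\mathcal E$ of two unitary channels put $\|\mathcal E\|_\diamond^E=\sup\|(\mathcal E\otimes\mathrm{id})\rho\|_1$, the supremum over all density operators $\rho$ on $\mathcal H\otimes\mathcal H$ with $\mathrm{Tr}[\rho(\hat n\otimes I)]\le E$, where $\|T\|_1=\mathrm{Tr}\sqrt{T^\dagger T}$. Computations are measured in a model with exact arithmetic: a program is a fixed finite list of instructions with counted loops that acts on natural-number registers (with addition and truncated subtraction) and on arrays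 of complex numbers, and each operation $+,-,\times,\div$, complex conjugation, square root of a non-negative real, zero test, memory access, index operation and loop iteration costs one step. The input of a program consists of $N$, $M$ and the $(N+1)\times(M+1)$ matrix $(\langle i|U|j\rangle)_{i\le N,\,j\le M}$ of $\Pi_NU\Pi_M$. Theorem. There are a constant $C>0$ and two programs $P$, $P'$ such that the following holds for every unitary $U$ on $\mathcal H$ with $U\mathcal S\subseteq\mathcal S$, every $E\ge 0$ and every $\epsilon>0$. Put $M=\lfloor 64E/\epsilon^2\rfloor$. Then $E_U(64E/\epsilon^2)<\infty$, and there are $N\in\mathbb N$ with $$N\le C\,\frac{\max(E,\epsilon^2)}{\epsilon^4}\,E_U\!\left(\frac{64E}{\epsilon^2}\right)$$ (so $N=\mathcal O\big(\frac{E}{\epsilon^4}E_U(\frac{64E}{\epsilon^2})\big)$ for $E\ge\epsilon^2$) and a unitary operator $V_N$ on $\mathcal H_N$ such that: 1. for every unitary operator $V'$ on $\mathcal H_N^\perp$, with $V=V_N\oplus V'$, $\mathcal U=U\cdot U^\dagger$ and $\mathcal V=V\cdot V^\dagger$, one has $\|\mathcal U-\mathcal V\|_\diamond^E\le\epsilon$;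 2. $V_N$ is the unitary factor of a QR factorization of $\Pi_NU\Pi_M$: the matrix of $\Pi_NU\Pi_M$ equals $V_NR$ with $R$ an upper triangular $(N+1)\times(M+1)$ matrix with non-negative real diagonal entries; 3. on the input $(N,M,\Pi_NU\Pi_M)$ the program $P$ outputs $V_N$ in factored form, that is, vectors $w_0,\dots,w_M\in\mathbb C^{N+1}$ and scalars $\tau_0,\dots,\tau_M$ with $V_N=\prod_{k=0}^{M}(I-\tau_kw_kw_k^\dagger)$ (ordered product), in at most $C(N+1)\max(E,\epsilon^2)^2/\epsilon^4$ steps; if moreover $\epsilon^2\le E$ and $\epsilon\le 2$, the number of steps is at most $C\frac{E^3}{\epsilon^8}E_U(\frac{64E}{\epsilon^2})$; 4. on the same input the program $P'$ outputs all $(N+1)^2$ Fock-basis matrix entries of $V_N$ in at most $C(N+1)^2\max(E,\epsilon^2)/\epsilon^2$ steps. -/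

import Mathlib

open scoped ENNReal Topology InnerProductSpace

noncomputable section

namespace Bosonic

/-! ### The single-mode Hilbert space -/

/-- The single-mode Hilbert space `ℋ = ℓ²(ℕ, ℂ)`; `ψ n` is the coefficient `⟨n|ψ⟩`. -/
abbrev FockSpace : Type := lp (fun _ : ℕ => ℂ) 2

/-- The Fock basis vector `|n⟩`. -/
def ket (n : ℕ) : FockSpace := lp.single 2 n (1 : ℂ)

/-- `ℋ_N = span {|0⟩, …, |N⟩} = Range Π_N`, the states with at most `N` particles. -/
def fockSubspace (N : ℕ) : Submodule ℂ FockSpace :=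
  Submodule.span ℂ (Set.range fun n : Fin (N + 1) => ket n)

instance (N : ℕ) : FiniteDimensional ℂ (fockSubspace N) :=
  FiniteDimensional.span_of_finite ℂ (Set.finite_range _)

theorem ket_mem_fockSubspace {N : ℕ} (n : Fin (N + 1)) : ket n ∈ fockSubspace N :=
  Submodule.subset_span ⟨n, rfl⟩

/-- The Schwartz space: coefficients decay faster than every power of `n`. -/
def IsSchwartz (ψ : FockSpace) : Prop :=
  ∀ k : ℕ, Filter.Tendsto (fun n : ℕ => ψ n * (n : ℂ) ^ k) Filter.atTop (𝓝 0)

/-- A physical unitary maps Schwartz states to Schwartz states. -/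
def IsPhysical (U : FockSpace ≃ₗᵢ[ℂ] FockSpace) : Prop :=
  ∀ ψ : FockSpace, IsSchwartz ψ → IsSchwartz (U ψ)

/-- The energy `⟨ψ|n̂|ψ⟩ = ∑ n |⟨n|ψ⟩|²`, possibly infinite. -/
def energy (ψ : FockSpace) : ℝ≥0∞ :=
  ∑' n : ℕ, (n : ℝ≥0∞) * ENNReal.ofReal (‖ψ n‖ ^ 2)

/-- `E_U(x)`: the supremum of `⟨ψ|U† n̂ U|ψ⟩` over the unit vectors `ψ` with at most `x` particles
(for real `x ≥ 0` this means at most `⌊x⌋` particles). -/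
def maximalEnergy (U : FockSpace ≃ₗᵢ[ℂ] FockSpace) (x : ℝ) : ℝ≥0∞ :=
  ⨆ ψ : FockSpace, ⨆ _ : ψ ∈ fockSubspace ⌊x⌋₊ ∧ ‖ψ‖ = 1, energy (U ψ)

/-- `U` as a bounded operator. -/
def toOperator (U : FockSpace ≃ₗᵢ[ℂ] FockSpace) : FockSpace →L[ℂ] FockSpace :=
  (U.toContinuousLinearEquiv : FockSpace →L[ℂ] FockSpace)

/-- The operator `V_N ⊕ V'` on `ℋ = ℋ_N ⊕ ℋ_Nᗮ`. -/
def directSum {N : ℕ} (VN : fockSubspace N ≃ₗᵢ[ℂ] fockSubspace N)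
    (V' : (fockSubspace N)ᗮ ≃ₗᵢ[ℂ] (fockSubspace N)ᗮ) : FockSpace →L[ℂ] FockSpace :=
  (fockSubspace N).subtypeL ∘L (VN.toContinuousLinearEquiv : fockSubspace N →L[ℂ] fockSubspace N)
      ∘L (fockSubspace N).orthogonalProjectionOnto
    + (fockSubspace N)ᗮ.subtypeL
      ∘L (V'.toContinuousLinearEquiv : (fockSubspace N)ᗮ →L[ℂ] (fockSubspace N)ᗮ)
      ∘L (fockSubspace N)ᗮ.orthogonalProjectionOnto

/-! ### The energy-constrained diamond norm -/

/-- The Hilbert space tensor product `ℋ ⊗ ℋ'` with `ℋ' = ℓ²(ℕ, ℂ)`, realised as `ℓ²(ℕ, ℋ)`: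
the sequence `(ψ_k)` stands for `∑ ψ_k ⊗ |k⟩`. -/
abbrev BipartiteSpace : Type := lp (fun _ : ℕ => FockSpace) 2

/-- The orthonormal basis vector `|n⟩ ⊗ |k⟩`, for `p = (n, k)`. -/
def ket₂ (p : ℕ × ℕ) : BipartiteSpace := lp.single 2 p.2 (ket p.1)

/-- `A ⊗ I`. -/
def ampliation (A : FockSpace →L[ℂ] FockSpace) : BipartiteSpace →L[ℂ] BipartiteSpace :=
  lp.mapCLM 2 (fun _ : ℕ => A) (norm_nonneg A) (fun _ => le_rfl)

theorem ampliation_apply (A : FockSpace →L[ℂ] FockSpace) (ψ : BipartiteSpace) (k : ℕ) :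
    ampliation A ψ k = A (ψ k) := rfl

/-- The diagonal matrix element `⟨n,k|T|n,k⟩` of a positive operator. -/
def diagonal (T : BipartiteSpace →L[ℂ] BipartiteSpace) (p : ℕ × ℕ) : ℝ≥0∞ :=
  ENNReal.ofReal (RCLike.re ⟪ket₂ p, T (ket₂ p)⟫_ℂ)

/-- The trace of a positive operator, possibly infinite. -/
def positiveTrace (T : BipartiteSpace →L[ℂ] BipartiteSpace) : ℝ≥0∞ :=
  ∑' p : ℕ × ℕ, diagonal T p

/-- `|T| = √(T† T)` for a bounded operator on a Hilbert space. -/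
def operatorAbs {K : Type*} [NormedAddCommGroup K] [InnerProductSpace ℂ K] [CompleteSpace K]
    (T : K →L[ℂ] K) : K →L[ℂ] K :=
  CFC.abs T

/-- The trace norm `‖T‖₁ = Tr √(T† T)`. -/
def traceNorm (T : BipartiteSpace →L[ℂ] BipartiteSpace) : ℝ≥0∞ :=
  positiveTrace (operatorAbs T)

def IsDensityOperator (ρ : BipartiteSpace →L[ℂ] BipartiteSpace) : Prop :=
  ρ.IsPositive ∧ positiveTrace ρ = 1

/-- `Tr[ρ (n̂ ⊗ I)]` for a positive operator `ρ`. -/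
def inputEnergy (ρ : BipartiteSpace →L[ℂ] BipartiteSpace) : ℝ≥0∞ :=
  ∑' p : ℕ × ℕ, (p.1 : ℝ≥0∞) * diagonal ρ p

/-- For the channel `𝒜 = A · A†`, the map `𝒜 ⊗ id : ρ ↦ (A ⊗ I) ρ (A ⊗ I)†`. -/
def ampliatedChannel (A : FockSpace →L[ℂ] FockSpace) :
    (BipartiteSpace →L[ℂ] BipartiteSpace) → (BipartiteSpace →L[ℂ] BipartiteSpace) :=
  fun ρ => ampliation A ∘L ρ ∘L ContinuousLinearMap.adjoint (ampliation A)

/-- The energy-constrained diamond norm `‖ℰ‖_⋄^E`, as a function of `Φ = ℰ ⊗ id`: the supremum of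
`‖Φ ρ‖₁` over the density operators `ρ` with `Tr[ρ (n̂ ⊗ I)] ≤ E`. -/
def ecDiamondNorm (E : ℝ)
    (Φ : (BipartiteSpace →L[ℂ] BipartiteSpace) → (BipartiteSpace →L[ℂ] BipartiteSpace)) : ℝ≥0∞ :=
  ⨆ ρ : BipartiteSpace →L[ℂ] BipartiteSpace,
    ⨆ _ : IsDensityOperator ρ ∧ inputEnergy ρ ≤ ENNReal.ofReal E, traceNorm (Φ ρ)

/-! ### Matrices in the Fock basis and QR factors -/

/-- The matrix of `Π_N U Π_M`: entries `⟨i|U|j⟩`, `i ≤ N`, `j ≤ M`. -/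
def truncation (U : FockSpace ≃ₗᵢ[ℂ] FockSpace) (N M : ℕ) :
    Matrix (Fin (N + 1)) (Fin (M + 1)) ℂ :=
  Matrix.of fun i j => U (ket j) (i : ℕ)

/-- The Fock basis matrix of a unitary operator on `ℋ_N`. -/
def fockMatrix {N : ℕ} (VN : fockSubspace N ≃ₗᵢ[ℂ] fockSubspace N) :
    Matrix (Fin (N + 1)) (Fin (N + 1)) ℂ :=
  Matrix.of fun i j => (VN ⟨ket j, ket_mem_fockSubspace j⟩ : FockSpace) (i : ℕ)

/-- `Q` is the unitary factor of a QR factorization `A = Q R`, with `R` upper triangular and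
with real non-negative diagonal (the normalization of the Gram–Schmidt process). -/
def IsQRFactor {n m : ℕ} (Q : Matrix (Fin n) (Fin n) ℂ) (A : Matrix (Fin n) (Fin m) ℂ) : Prop :=
  Q ∈ Matrix.unitaryGroup (Fin n) ℂ ∧ ∃ R : Matrix (Fin n) (Fin m) ℂ, A = Q * R ∧
    (∀ (i : Fin n) (j : Fin m), (j : ℕ) < (i : ℕ) → R i j = 0) ∧
    (∀ (i : Fin n) (j : Fin m), (i : ℕ) = (j : ℕ) → 0 ≤ (R i j).re ∧ (R i j).im = 0)

/-! ### A machine model with exact scalar arithmetic and a step count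

Programs act on natural-number registers (used for loop counters and addresses) and on
two-dimensional arrays of complex scalars. Every node of an expression and every executed
instruction costs one step. -/

/-- The memory of the machine: `reg x` is a register, `mem a i j` is entry `(i, j)` of array `a`. -/
structure Store where
  reg : ℕ → ℕ
  mem : ℕ → ℕ → ℕ → ℂ

def Store.setReg (s : Store) (x v : ℕ) : Store :=
  { s with reg := fun y => if y = x then v else s.reg y }

def Store.setMem (s : Store) (a i j : ℕ) (z : ℂ) : Store :=
  { s with mem := fun b k l => if b = a ∧ k = i ∧ l = j then z else s.mem b k l }

/-- Index expressions; `sub` is truncated subtraction. -/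
inductive IndexExpr where
  | const (n : ℕ)
  | var (x : ℕ)
  | add (e f : IndexExpr)
  | sub (e f : IndexExpr)

def IndexExpr.eval (s : Store) : IndexExpr → ℕ
  | const n => n
  | var x => s.reg x
  | add e f => e.eval s + f.eval s
  | sub e f => e.eval s - f.eval s

def IndexExpr.size : IndexExpr → ℕ
  | const _ => 1
  | var _ => 1
  | add e f => e.size + f.size + 1
  | sub e f => e.size + f.size + 1

/-- Scalar expressions; division by zero returns zero, and `sqrt` is the square root of a
non-negative real number (applied to the real part). -/
inductive ScalarExpr where
  | const (n : ℕ)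
  | read (a : ℕ) (i j : IndexExpr)
  | add (e f : ScalarExpr)
  | sub (e f : ScalarExpr)
  | mul (e f : ScalarExpr)
  | div (e f : ScalarExpr)
  | conj (e : ScalarExpr)
  | sqrt (e : ScalarExpr)

def ScalarExpr.eval (s : Store) : ScalarExpr → ℂ
  | const n => (n : ℂ)
  | read a i j => s.mem a (i.eval s) (j.eval s)
  | add e f => e.eval s + f.eval s
  | sub e f => e.eval s - f.eval s
  | mul e f => e.eval s * f.eval s
  | div e f => e.eval s / f.eval s
  | conj e => star (e.eval s)
  | sqrt e => (Real.sqrt (e.eval s).re : ℂ)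

def ScalarExpr.size : ScalarExpr → ℕ
  | const _ => 1
  | read _ i j => i.size + j.size + 1
  | add e f => e.size + f.size + 1
  | sub e f => e.size + f.size + 1
  | mul e f => e.size + f.size + 1
  | div e f => e.size + f.size + 1
  | conj e => e.size + 1
  | sqrt e => e.size + 1

/-- Programs: register assignment, storing a scalar at an array position, sequencing, a zero test,
and counted loops (`loop x e c` runs `c` for `x = 0, …, e - 1`, with `e` evaluated once). -/
inductive Program where
  | assign (x : ℕ) (e : IndexExpr)
  | store (a : ℕ) (i j : IndexExpr) (e : ScalarExpr)
  | seq (c d : Program)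
  | ifZero (e : ScalarExpr) (c d : Program)
  | loop (x : ℕ) (e : IndexExpr) (c : Program)

/-- Run `f 0`, …, `f (n - 1)` in this order, adding up the steps and one step per iteration. -/
def iterate (f : ℕ → Store → Store × ℕ) : ℕ → Store → Store × ℕ
  | 0, s => (s, 0)
  | n + 1, s =>
    ((f n (iterate f n s).1).1, (iterate f n s).2 + (f n (iterate f n s).1).2 + 1)

/-- The final memory and the number of steps of a program. -/
def Program.exec : Program → Store → Store × ℕ
  | assign x e, s => (s.setReg x (e.eval s), e.size + 1)
  | store a i j e, s =>
    (s.setMem a (i.eval s) (j.eval s) (e.eval s), i.size + j.size + e.size + 1)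
  | seq c d, s => ((d.exec (c.exec s).1).1, (c.exec s).2 + (d.exec (c.exec s).1).2)
  | ifZero e c d, s =>
    if e.eval s = 0 then ((c.exec s).1, (c.exec s).2 + e.size + 1)
    else ((d.exec s).1, (d.exec s).2 + e.size + 1)
  | loop x e c, s =>
    ((iterate (fun k t => c.exec (t.setReg x k)) (e.eval s) s).1,
      (iterate (fun k t => c.exec (t.setReg x k)) (e.eval s) s).2 + e.size + 1)

/-- The initial memory: `N` in register 0, `M` in register 1, the matrix `A` in array 0, and zero
everywhere else. -/
def inputStore {N M : ℕ} (A : Matrix (Fin (N + 1)) (Fin (M + 1)) ℂ) : Store where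
  reg x := if x = 0 then N else if x = 1 then M else 0
  mem a i j := if h : a = 0 ∧ i < N + 1 ∧ j < M + 1 then A ⟨i, h.2.1⟩ ⟨j, h.2.2⟩ else 0

/-- Output of a matrix by its entries: array 1 holds the matrix. -/
def Store.outputMatrix (s : Store) (n : ℕ) : Matrix (Fin n) (Fin n) ℂ :=
  Matrix.of fun i j => s.mem 1 i j

/-- Output of a unitary matrix in factored form, as the ordered product of the `m` Householder
factors `I - τ_k w_k w_k†`, `k = 0, …, m - 1`: column `k` of array 1 holds `w_k`, and entry `(k, 0)`
of array 2 holds `τ_k`. -/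
def Store.outputReflectors (s : Store) (n m : ℕ) : Matrix (Fin n) (Fin n) ℂ :=
  ((List.range m).map fun k =>
    (1 : Matrix (Fin n) (Fin n) ℂ) - s.mem 2 k 0 •
      Matrix.vecMulVec (fun i : Fin n => s.mem 1 i k) (fun i : Fin n => star (s.mem 1 i k))).prod

/-- Final memory of `P` on input `(N, M, A)`. -/
def Program.output (P : Program) {N M : ℕ} (A : Matrix (Fin (N + 1)) (Fin (M + 1)) ℂ) : Store :=
  (P.exec (inputStore A)).1

/-- Number of steps of `P` on input `(N, M, A)`. -/
def Program.time (P : Program) {N M : ℕ} (A : Matrix (Fin (N + 1)) (Fin (M + 1)) ℂ) : ℕ :=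
  (P.exec (inputStore A)).2

end Bosonic

end

open Bosonic

/-!
Since `U` maps `ℋ_M` into states of energy at most `E_U(64 E / ε²)`, at most the fraction
`E_U / (N + 1)` of the image of a state of `ℋ_M` leaks out of `ℋ_N`, so that `Π_N U Π_M` is almost
isometric for large `N`. The diagonal of the factor `R` of an almost isometric `V_N R` is close to
one: a vector `y` supported on the first `j + 1` coordinates with `R y` supported on row `j` shows
`|R_jj| ≥ ‖R y‖ / ‖y‖`. As `R_jj = ⟨V_N e_j, U e_j⟩ ≥ 0`, the columns `V_N e_j` and `U e_j` nearly
agree. By the Markov inequality `‖(1 - Π_M) φ‖² ≤ ⟨φ, n̂ φ⟩ / (M + 1)`, a small difference on `ℋ_M`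
suffices for the energy-constrained norm: writing a state as `ρ = σ²`, the trace norm is bounded by
Hilbert–Schmidt norms of `(U - V) σ`, which are controlled by the trace and the energy of `ρ`.

Householder's algorithm computes the unitary factor as a product of `min N M + 1` reflectors, each
of which is determined and applied to the remaining matrix with `O(N M)` operations. Multiplying the
reflectors out, the last one first, gives the entries. The step counts become energy bounds because
`M + 1 ≤ 65 max(E, ε²) / ε²`, and because `N + 1` is itself bounded by the effective dimension.
-/

namespace Bosonic

/-! ### Hilbert–Schmidt and trace norms -/

section HilbertSchmidt

variable {ι κ 𝕜 H K : Type*} [RCLike 𝕜]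
  [NormedAddCommGroup H] [InnerProductSpace 𝕜 H] [NormedAddCommGroup K] [InnerProductSpace 𝕜 K]

theorem ofReal_norm_sq {G : Type*} [SeminormedAddGroup G] (x : G) :
    ENNReal.ofReal (‖x‖ ^ 2) = ‖x‖ₑ ^ 2 := by
  rw [ENNReal.ofReal_pow (norm_nonneg x), ofReal_norm]

theorem tsum_enorm_sq {G : ι → Type*} [∀ i, NormedAddCommGroup (G i)] (f : lp G 2) :
    ∑' i, ‖f i‖ₑ ^ 2 = ‖f‖ₑ ^ 2 := by
  have h := lp.hasSum_norm (p := 2) (by norm_num) f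
  simp only [ENNReal.toReal_ofNat, Real.rpow_two] at h
  simp_rw [← ofReal_norm_sq, ← h.tsum_eq]
  exact (ENNReal.ofReal_tsum_of_nonneg (fun i => sq_nonneg _) h.summable).symm

theorem tsum_enorm_inner_sq (b : HilbertBasis ι 𝕜 H) (x : H) :
    ∑' i, ‖⟪b i, x⟫_𝕜‖ₑ ^ 2 = ‖x‖ₑ ^ 2 := by
  simp_rw [← b.repr_apply_apply, tsum_enorm_sq, b.repr.enorm_map]

theorem tsum_mul_le_sqrt_mul_sqrt (f g : ι → ℝ≥0∞) :
    ∑' i, f i * g i ≤ (∑' i, f i ^ 2) ^ (1 / 2 : ℝ) * (∑' i, g i ^ 2) ^ (1 / 2 : ℝ) := by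
  rw [ENNReal.tsum_eq_iSup_sum]
  refine iSup_le fun s => (ENNReal.inner_le_Lp_mul_Lq s f g Real.HolderConjugate.two_two).trans ?_
  simp only [ENNReal.rpow_two]
  gcongr <;> exact ENNReal.sum_le_tsum s

/-- The squared Hilbert–Schmidt norm `∑ ‖X bᵢ‖²` of an operator, computed in the orthonormal
basis `b` of its domain; possibly infinite. -/
noncomputable def hilbertSchmidtSq (b : HilbertBasis ι 𝕜 H) (X : H →L[𝕜] K) : ℝ≥0∞ :=
  ∑' i, ‖X (b i)‖ₑ ^ 2

theorem hilbertSchmidtSq_neg (b : HilbertBasis ι 𝕜 H) (X : H →L[𝕜] K) :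
    hilbertSchmidtSq b (-X) = hilbertSchmidtSq b X := by
  simp only [hilbertSchmidtSq, neg_apply, enorm_neg]

theorem hilbertSchmidtSq_comp_le {L : Type*} [NormedAddCommGroup L] [InnerProductSpace 𝕜 L]
    (b : HilbertBasis ι 𝕜 H) {S : K →L[𝕜] L} (hS : ‖S‖ ≤ 1) (X : H →L[𝕜] K) :
    hilbertSchmidtSq b (S ∘L X) ≤ hilbertSchmidtSq b X := by
  refine ENNReal.tsum_le_tsum fun i => pow_le_pow_left₀ zero_le (enorm_le_iff_norm_le.2 ?_) 2
  simpa using S.le_of_opNorm_le hS (X (b i))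

variable [CompleteSpace H] [CompleteSpace K]

theorem tsum_mul_enorm_inner_sq_comm (b : HilbertBasis ι 𝕜 H) (c : HilbertBasis κ 𝕜 K)
    (X : H →L[𝕜] K) (w : κ → ℝ≥0∞) :
    ∑' i, ∑' j, w j * ‖⟪c j, X (b i)⟫_𝕜‖ₑ ^ 2 =
      ∑' j, w j * ‖ContinuousLinearMap.adjoint X (c j)‖ₑ ^ 2 := by
  rw [ENNReal.tsum_comm]
  refine tsum_congr fun j => ?_
  rw [ENNReal.tsum_mul_left, ← tsum_enorm_inner_sq b]
  simp_rw [ContinuousLinearMap.adjoint_inner_right, ← ofReal_norm_sq, norm_inner_symm]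

theorem hilbertSchmidtSq_adjoint (b : HilbertBasis ι 𝕜 H) (c : HilbertBasis κ 𝕜 K)
    (X : H →L[𝕜] K) :
    hilbertSchmidtSq c (ContinuousLinearMap.adjoint X) = hilbertSchmidtSq b X := by
  simpa [hilbertSchmidtSq, tsum_enorm_inner_sq] using (tsum_mul_enorm_inner_sq_comm b c X 1).symm

theorem tsum_enorm_inner_comp_adjoint_le (b : HilbertBasis ι 𝕜 H) (c : HilbertBasis κ 𝕜 K)
    (X Y : H →L[𝕜] K) :
    ∑' j, ‖⟪c j, X (ContinuousLinearMap.adjoint Y (c j))⟫_𝕜‖ₑ ≤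
      hilbertSchmidtSq b X ^ (1 / 2 : ℝ) * hilbertSchmidtSq b Y ^ (1 / 2 : ℝ) := by
  rw [← hilbertSchmidtSq_adjoint b c X, ← hilbertSchmidtSq_adjoint b c Y]
  refine (ENNReal.tsum_le_tsum fun j => ?_).trans (tsum_mul_le_sqrt_mul_sqrt _ _)
  rw [← ContinuousLinearMap.adjoint_inner_left]
  simpa only [← ofReal_norm, ← ENNReal.ofReal_mul (norm_nonneg _)] using
    ENNReal.ofReal_le_ofReal (norm_inner_le_norm _ _)

end HilbertSchmidt

section PolarDecomposition

variable {A : Type*} [CStarAlgebra A] [PartialOrder A] [StarOrderedRing A]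

-- `s = (|a| + η)⁻¹ a†` approximates the adjoint of the phase in the polar decomposition of `a`.
theorem exists_norm_le_one_norm_abs_sub_mul_le (a : A) {η : ℝ} (hη : 0 < η) :
    ∃ s : A, ‖s‖ ≤ 1 ∧ ‖CFC.abs a - s * a‖ ≤ η := by
  obtain ⟨f, hf, hf_le, hf_sub⟩ : ∃ f : ℝ → ℝ, Continuous f ∧ (∀ t, |f t * t| ≤ 1) ∧
      ∀ t, 0 ≤ t → t - f t * t * t = f t * t * η := by
    have hpos (t : ℝ) : 0 < |t| + η := by positivity
    refine ⟨fun t => (|t| + η)⁻¹, by fun_prop (disch := exact fun t => (hpos t).ne'),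
      fun t => ?_, fun t ht => ?_⟩
    · rw [abs_mul, abs_inv, abs_of_pos (hpos t), inv_mul_le_one₀ (hpos t)]
      linarith
    · simp only [abs_of_nonneg ht]
      field_simp [show t + η ≠ 0 by positivity]
      ring
  set r := cfc f (CFC.abs a) with hr
  have ha : IsSelfAdjoint (CFC.abs a) := (CFC.abs_nonneg a).isSelfAdjoint
  have hr_star : star r = r := (cfc_predicate f (CFC.abs a) : IsSelfAdjoint r)
  have hra : r * (star a * a) = cfc (fun t : ℝ => f t * t * t) (CFC.abs a) := by
    rw [← CFC.abs_mul_abs a, ← mul_assoc, cfc_mul (fun t => f t * t) fun t => t,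
      cfc_mul f fun t => t, cfc_id' ℝ (CFC.abs a)]
  refine ⟨r * star a, ?_, ?_⟩
  · have hss : r * star a * star (r * star a) =
        cfc (fun t : ℝ => f t * t * t * f t) (CFC.abs a) := by
      rw [cfc_mul (fun t => f t * t * t) f, ← hra, ← hr, star_mul, star_star, hr_star]
      simp only [mul_assoc]
    have hsq : ‖r * star a‖ * ‖r * star a‖ ≤ 1 := by
      rw [← CStarRing.norm_self_mul_star, hss]
      refine norm_cfc_le zero_le_one fun t _ => ?_
      rw [show f t * t * t * f t = (f t * t) ^ 2 by ring, norm_pow]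
      exact pow_le_one₀ (norm_nonneg _) (hf_le t)
    nlinarith [norm_nonneg (r * star a)]
  · rw [mul_assoc, hra]
    nth_rw 1 [← cfc_id' ℝ (CFC.abs a)]
    rw [← cfc_sub (fun t : ℝ => t) fun t => f t * t * t]
    refine norm_cfc_le hη.le fun t ht => ?_
    have ht0 : 0 ≤ t := spectrum_nonneg_of_nonneg (CFC.abs_nonneg a) ht
    rw [hf_sub t ht0, norm_mul, Real.norm_of_nonneg hη.le]
    exact mul_le_of_le_one_left hη.le (hf_le t)

end PolarDecomposition

theorem exists_isSelfAdjoint_comp_self {K : Type*} [NormedAddCommGroup K] [InnerProductSpace ℂ K]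
    [CompleteSpace K] {ρ : K →L[ℂ] K} (hρ : ρ.IsPositive) :
    ∃ σ : K →L[ℂ] K, IsSelfAdjoint σ ∧ ρ = σ ∘L σ :=
  ⟨CFC.sqrt ρ, (CFC.sqrt_nonneg ρ).isSelfAdjoint,
    (CFC.sqrt_mul_sqrt_self ρ (ρ.nonneg_iff_isPositive.2 hρ)).symm⟩

theorem inner_ket (n : ℕ) (ψ : FockSpace) : ⟪ket n, ψ⟫_ℂ = ψ n := by
  simp [ket, lp.inner_single_left]

theorem inner_ket₂ (p : ℕ × ℕ) (ψ : BipartiteSpace) : ⟪ket₂ p, ψ⟫_ℂ = ψ p.2 p.1 := by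
  rw [ket₂, lp.inner_single_left, inner_ket]

theorem norm_ket (n : ℕ) : ‖ket n‖ = 1 := by
  rw [ket, lp.norm_single (by norm_num), norm_one]

theorem norm_ket₂ (p : ℕ × ℕ) : ‖ket₂ p‖ = 1 := by
  rw [ket₂, lp.norm_single (by norm_num), norm_ket]

theorem ket_apply (n i : ℕ) : ket n i = if i = n then 1 else 0 := by
  rw [ket, lp.single_apply, Pi.single_apply]

theorem orthonormal_ket : Orthonormal ℂ ket := by
  rw [orthonormal_iff_ite]
  intro i j
  rw [inner_ket, ket_apply]

theorem orthonormal_ket₂ : Orthonormal ℂ ket₂ := by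
  rw [orthonormal_iff_ite]
  intro p q
  rw [inner_ket₂, ket₂, lp.single_apply, Pi.single_apply]
  by_cases h : p.2 = q.2 <;> simp [h, ket_apply, Prod.ext_iff]

/-- The orthonormal basis `|n⟩ ⊗ |k⟩` of `ℋ ⊗ ℋ'`. -/
noncomputable def ket₂Basis : HilbertBasis (ℕ × ℕ) ℂ BipartiteSpace :=
  HilbertBasis.mkOfOrthogonalEqBot orthonormal_ket₂ <| by
    refine (Submodule.eq_bot_iff _).2 fun ψ hψ => ?_
    ext k n
    rw [← inner_ket₂ (n, k) ψ]
    exact hψ _ (Submodule.subset_span ⟨(n, k), rfl⟩)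

theorem ket₂Basis_apply (p : ℕ × ℕ) : ket₂Basis p = ket₂ p :=
  congrFun (HilbertBasis.coe_mkOfOrthogonalEqBot _ _) p

theorem traceNorm_le_of_forall_contraction {T : BipartiteSpace →L[ℂ] BipartiteSpace} {c : ℝ≥0∞}
    (h : ∀ S : BipartiteSpace →L[ℂ] BipartiteSpace, ‖S‖ ≤ 1 →
      ∑' p, ‖⟪ket₂ p, S (T (ket₂ p))⟫_ℂ‖ₑ ≤ c) : traceNorm T ≤ c := by
  rw [traceNorm, positiveTrace, ENNReal.tsum_eq_iSup_sum]
  refine iSup_le fun F => ENNReal.le_of_forall_pos_le_add fun δ hδ _ => ?_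
  obtain ⟨S, hS, hST⟩ : ∃ S : BipartiteSpace →L[ℂ] BipartiteSpace, ‖S‖ ≤ 1 ∧
      ‖operatorAbs T - S ∘L T‖ ≤ δ / (F.card + 1) :=
    exists_norm_le_one_norm_abs_sub_mul_le T (by positivity)
  have hdiag (p : ℕ × ℕ) : diagonal (operatorAbs T) p ≤
      ‖⟪ket₂ p, S (T (ket₂ p))⟫_ℂ‖ₑ + ENNReal.ofReal (δ / (F.card + 1)) := by
    have hsplit : operatorAbs T (ket₂ p) = S (T (ket₂ p)) + (operatorAbs T - S ∘L T) (ket₂ p) :=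
      (add_sub_cancel _ _).symm
    rw [diagonal, hsplit, ← ofReal_norm, ← ENNReal.ofReal_add (norm_nonneg _) (by positivity)]
    refine ENNReal.ofReal_le_ofReal ((RCLike.re_le_norm _).trans ?_)
    rw [inner_add_right]
    refine (norm_add_le _ _).trans (add_le_add_right ((norm_inner_le_norm _ _).trans ?_) _)
    simpa [norm_ket₂] using ContinuousLinearMap.le_of_opNorm_le _ hST (ket₂ p)
  calc ∑ p ∈ F, diagonal (operatorAbs T) p
      ≤ ∑ p ∈ F, (‖⟪ket₂ p, S (T (ket₂ p))⟫_ℂ‖ₑ + ENNReal.ofReal (δ / (F.card + 1))) :=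
        Finset.sum_le_sum fun p _ => hdiag p
    _ ≤ c + F.card * ENNReal.ofReal (δ / (F.card + 1)) := by
        rw [Finset.sum_add_distrib, Finset.sum_const, nsmul_eq_mul]
        gcongr
        exact (ENNReal.sum_le_tsum F).trans (h S hS)
    _ ≤ c + δ := by
        rw [← ENNReal.ofReal_natCast, ← ENNReal.ofReal_mul (Nat.cast_nonneg _),
          ← ENNReal.ofReal_coe_nnreal]
        gcongr
        rw [mul_div_assoc', div_le_iff₀ (by positivity)]
        nlinarith [δ.coe_nonneg]

theorem traceNorm_add_comp_adjoint_le (X₁ Y₁ X₂ Y₂ : BipartiteSpace →L[ℂ] BipartiteSpace) :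
    traceNorm (X₁ ∘L ContinuousLinearMap.adjoint Y₁ + X₂ ∘L ContinuousLinearMap.adjoint Y₂) ≤
      hilbertSchmidtSq ket₂Basis X₁ ^ (1 / 2 : ℝ) * hilbertSchmidtSq ket₂Basis Y₁ ^ (1 / 2 : ℝ) +
      hilbertSchmidtSq ket₂Basis X₂ ^ (1 / 2 : ℝ) *
        hilbertSchmidtSq ket₂Basis Y₂ ^ (1 / 2 : ℝ) := by
  refine traceNorm_le_of_forall_contraction fun S hS => ?_
  have hterm (X Y : BipartiteSpace →L[ℂ] BipartiteSpace) :
      ∑' p, ‖⟪ket₂ p, S (X (ContinuousLinearMap.adjoint Y (ket₂ p)))⟫_ℂ‖ₑ ≤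
        hilbertSchmidtSq ket₂Basis X ^ (1 / 2 : ℝ) *
          hilbertSchmidtSq ket₂Basis Y ^ (1 / 2 : ℝ) := by
    have := tsum_enorm_inner_comp_adjoint_le ket₂Basis ket₂Basis (S ∘L X) Y
    simp only [ket₂Basis_apply, ContinuousLinearMap.comp_apply] at this
    refine this.trans ?_
    gcongr
    exact hilbertSchmidtSq_comp_le _ hS X
  refine le_trans ?_ (add_le_add (hterm X₁ Y₁) (hterm X₂ Y₂))
  rw [← ENNReal.tsum_add]
  refine ENNReal.tsum_le_tsum fun p => ?_
  simp only [add_apply, ContinuousLinearMap.comp_apply, map_add, inner_add_right]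
  exact enorm_add_le _ _

/-! ### The energy-constrained diamond norm -/

section SquareRoot

variable {σ : BipartiteSpace →L[ℂ] BipartiteSpace}

theorem diagonal_comp_self (hσ : IsSelfAdjoint σ) (p : ℕ × ℕ) :
    diagonal (σ ∘L σ) p = ‖σ (ket₂ p)‖ₑ ^ 2 := by
  rw [diagonal, ContinuousLinearMap.comp_apply, ← ContinuousLinearMap.adjoint_inner_left,
    hσ.adjoint_eq, inner_self_eq_norm_sq, ofReal_norm_sq]

theorem hilbertSchmidtSq_eq_positiveTrace (hσ : IsSelfAdjoint σ) :
    hilbertSchmidtSq ket₂Basis σ = positiveTrace (σ ∘L σ) :=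
  tsum_congr fun p => by rw [diagonal_comp_self hσ, ket₂Basis_apply]

theorem energy_eq_tsum_enorm (ψ : FockSpace) : energy ψ = ∑' n : ℕ, n * ‖ψ n‖ₑ ^ 2 := by
  simp only [energy, ofReal_norm_sq]

theorem tsum_energy_eq_inputEnergy (hσ : IsSelfAdjoint σ) :
    ∑' p, ∑' k, energy (σ (ket₂ p) k) = inputEnergy (σ ∘L σ) := by
  have h := tsum_mul_enorm_inner_sq_comm ket₂Basis ket₂Basis σ fun q => (q.1 : ℝ≥0∞)
  rw [hσ.adjoint_eq] at h
  simp only [ket₂Basis_apply, inner_ket₂, ← diagonal_comp_self hσ] at h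
  rw [inputEnergy, ← h]
  refine tsum_congr fun p => ?_
  rw [ENNReal.tsum_prod', ENNReal.tsum_comm]
  simp only [energy_eq_tsum_enorm]

theorem ampliatedChannel_comp_self (hσ : IsSelfAdjoint σ) (A : FockSpace →L[ℂ] FockSpace) :
    ampliatedChannel A (σ ∘L σ) =
      (ampliation A ∘L σ) ∘L ContinuousLinearMap.adjoint (ampliation A ∘L σ) := by
  rw [ContinuousLinearMap.adjoint_comp, hσ.adjoint_eq]
  rfl

theorem hilbertSchmidtSq_ampliation_comp_le (hσ : IsSelfAdjoint σ) {D : FockSpace →L[ℂ] FockSpace}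
    {a b : ℝ≥0∞} (hD : ∀ φ, ‖D φ‖ₑ ^ 2 ≤ a * ‖φ‖ₑ ^ 2 + b * energy φ) :
    hilbertSchmidtSq ket₂Basis (ampliation D ∘L σ) ≤
      a * positiveTrace (σ ∘L σ) + b * inputEnergy (σ ∘L σ) := by
  rw [← hilbertSchmidtSq_eq_positiveTrace hσ, ← tsum_energy_eq_inputEnergy hσ, hilbertSchmidtSq,
    hilbertSchmidtSq, ← ENNReal.tsum_mul_left, ← ENNReal.tsum_mul_left, ← ENNReal.tsum_add]
  simp only [ket₂Basis_apply]
  refine ENNReal.tsum_le_tsum fun p => ?_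
  rw [ContinuousLinearMap.comp_apply, ← tsum_enorm_sq, ← tsum_enorm_sq (σ (ket₂ p)),
    ← ENNReal.tsum_mul_left, ← ENNReal.tsum_mul_left, ← ENNReal.tsum_add]
  exact ENNReal.tsum_le_tsum fun k => hD _

end SquareRoot

theorem ampliation_sub (A B : FockSpace →L[ℂ] FockSpace) :
    ampliation (A - B) = ampliation A - ampliation B := by
  ext ψ k n
  rfl

theorem norm_ampliation_le (A : FockSpace →L[ℂ] FockSpace) : ‖ampliation A‖ ≤ ‖A‖ :=
  lp.norm_mapCLM_le 2 _ (norm_nonneg A) fun _ => le_rfl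

theorem ecDiamondNorm_le_of_forall_isSelfAdjoint {E : ℝ} {c : ℝ≥0∞}
    {Φ : (BipartiteSpace →L[ℂ] BipartiteSpace) → (BipartiteSpace →L[ℂ] BipartiteSpace)}
    (h : ∀ σ : BipartiteSpace →L[ℂ] BipartiteSpace, IsSelfAdjoint σ →
      hilbertSchmidtSq ket₂Basis σ = 1 → positiveTrace (σ ∘L σ) = 1 →
      inputEnergy (σ ∘L σ) ≤ ENNReal.ofReal E → traceNorm (Φ (σ ∘L σ)) ≤ c) :
    ecDiamondNorm E Φ ≤ c := by
  refine iSup₂_le fun ρ ⟨⟨hpos, htr⟩, hen⟩ => ?_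
  obtain ⟨σ, hσ, rfl⟩ := exists_isSelfAdjoint_comp_self hpos
  exact h σ hσ ((hilbertSchmidtSq_eq_positiveTrace hσ).trans htr) htr hen

section

variable {A B : FockSpace →L[ℂ] FockSpace}

theorem hilbertSchmidtSq_ampliation_comp_rpow_le_one {σ : BipartiteSpace →L[ℂ] BipartiteSpace}
    (hσ : hilbertSchmidtSq ket₂Basis σ = 1) (hA : ‖A‖ ≤ 1) :
    hilbertSchmidtSq ket₂Basis (ampliation A ∘L σ) ^ (1 / 2 : ℝ) ≤ 1 :=
  ENNReal.rpow_le_one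
    ((hilbertSchmidtSq_comp_le _ ((norm_ampliation_le A).trans hA) σ).trans hσ.le) (by norm_num)

theorem ecDiamondNorm_sub_le_two (hA : ‖A‖ ≤ 1) (hB : ‖B‖ ≤ 1) (E : ℝ) :
    ecDiamondNorm E (ampliatedChannel A - ampliatedChannel B) ≤ 2 := by
  refine ecDiamondNorm_le_of_forall_isSelfAdjoint fun σ hσ hσ1 _ _ => ?_
  rw [Pi.sub_apply, ampliatedChannel_comp_self hσ, ampliatedChannel_comp_self hσ, sub_eq_add_neg,
    ← ContinuousLinearMap.neg_comp]
  refine (traceNorm_add_comp_adjoint_le _ _ _ _).trans ?_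
  have hA1 := hilbertSchmidtSq_ampliation_comp_rpow_le_one hσ1 hA
  have hB1 := hilbertSchmidtSq_ampliation_comp_rpow_le_one hσ1 hB
  rw [hilbertSchmidtSq_neg]
  exact (add_le_add (mul_le_one' hA1 hA1) (mul_le_one' hB1 hB1)).trans one_add_one_eq_two.le

-- `A ρ A† - B ρ B† = A √ρ ((A - B) √ρ)† + (A - B) √ρ (B √ρ)†`, and the Hilbert–Schmidt norm of
-- `(A - B) √ρ` is controlled by the trace and the energy of `ρ`.
theorem ecDiamondNorm_sub_le (hA : ‖A‖ ≤ 1) (hB : ‖B‖ ≤ 1) {a b : ℝ≥0∞}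
    (hAB : ∀ φ, ‖(A - B) φ‖ₑ ^ 2 ≤ a * ‖φ‖ₑ ^ 2 + b * energy φ) (E : ℝ) :
    ecDiamondNorm E (ampliatedChannel A - ampliatedChannel B) ≤
      2 * (a + b * ENNReal.ofReal E) ^ (1 / 2 : ℝ) := by
  refine ecDiamondNorm_le_of_forall_isSelfAdjoint fun σ hσ hσ1 htr hen => ?_
  have hD : hilbertSchmidtSq ket₂Basis (ampliation (A - B) ∘L σ) ≤ a + b * ENNReal.ofReal E := by
    refine (hilbertSchmidtSq_ampliation_comp_le hσ hAB).trans ?_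
    rw [htr, mul_one]
    gcongr
  have hsplit : ampliatedChannel A (σ ∘L σ) - ampliatedChannel B (σ ∘L σ) =
      (ampliation A ∘L σ) ∘L ContinuousLinearMap.adjoint (ampliation (A - B) ∘L σ) +
        (ampliation (A - B) ∘L σ) ∘L ContinuousLinearMap.adjoint (ampliation B ∘L σ) := by
    rw [ampliatedChannel_comp_self hσ, ampliatedChannel_comp_self hσ, ampliation_sub,
      ContinuousLinearMap.sub_comp, map_sub, ContinuousLinearMap.comp_sub,
      ContinuousLinearMap.sub_comp, sub_add_sub_cancel]
  rw [Pi.sub_apply, hsplit, two_mul]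
  refine (traceNorm_add_comp_adjoint_le _ _ _ _).trans (add_le_add ?_ ?_)
  · refine (mul_le_of_le_one_left' (hilbertSchmidtSq_ampliation_comp_rpow_le_one hσ1 hA)).trans ?_
    gcongr
  · refine (mul_le_of_le_one_right' (hilbertSchmidtSq_ampliation_comp_rpow_le_one hσ1 hB)).trans ?_
    gcongr

end

/-! ### Truncation to finitely many Fock states -/

/-- The vector `∑ x_j |j⟩` with finitely many coefficients. -/
noncomputable def fockVector {n : ℕ} (x : Fin n → ℂ) : FockSpace := ∑ j, x j • ket j

theorem fockVector_apply {n : ℕ} (x : Fin n → ℂ) (i : ℕ) :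
    fockVector x i = if h : i < n then x ⟨i, h⟩ else 0 := by
  rw [← inner_ket, fockVector, inner_sum]
  simp only [inner_smul_right, inner_ket, ket_apply, mul_ite, mul_one, mul_zero]
  split_ifs with h
  · exact (Finset.sum_eq_single ⟨i, h⟩ (fun j _ hj => if_neg fun h' => hj (Fin.ext h'.symm))
      (by simp)).trans (if_pos rfl)
  · exact Finset.sum_eq_zero fun j _ => if_neg (by omega)

theorem inner_fockVector_left {n : ℕ} (x : Fin n → ℂ) (φ : FockSpace) :
    ⟪fockVector x, φ⟫_ℂ = ∑ j, star (x j) * φ j := by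
  simp_rw [fockVector, sum_inner, inner_smul_left, inner_ket, starRingEnd_apply]

theorem norm_sq_fockVector {n : ℕ} (x : Fin n → ℂ) : ‖fockVector x‖ ^ 2 = ∑ j, ‖x j‖ ^ 2 := by
  have ho : Orthonormal ℂ fun j : Fin n => ket j := orthonormal_ket.comp _ Fin.val_injective
  have h := ho.inner_sum x x Finset.univ
  rw [← fockVector, inner_self_eq_norm_sq_to_K] at h
  simp only [RCLike.conj_mul] at h
  exact_mod_cast h

theorem fockVector_mem_fockSubspace {N : ℕ} (x : Fin (N + 1) → ℂ) :
    fockVector x ∈ fockSubspace N :=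
  Submodule.sum_mem _ fun j _ => Submodule.smul_mem _ _ (ket_mem_fockSubspace j)

theorem exists_eq_fockVector {N : ℕ} {ψ : FockSpace} (hψ : ψ ∈ fockSubspace N) :
    ∃ x : Fin (N + 1) → ℂ, ψ = fockVector x := by
  obtain ⟨x, hx⟩ := (Submodule.mem_span_range_iff_exists_fun ℂ).1 hψ
  exact ⟨x, hx.symm⟩

theorem fockVector_ne_zero {n : ℕ} {x : Fin n → ℂ} (hx : x ≠ 0) : fockVector x ≠ 0 := by
  obtain ⟨j, hj⟩ := Function.ne_iff.1 hx
  refine fun h => hj ?_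
  simpa [fockVector_apply] using congrArg (fun φ : FockSpace => φ j) h

theorem starProjection_fockSubspace (N : ℕ) (φ : FockSpace) :
    (fockSubspace N).starProjection φ = fockVector fun j : Fin (N + 1) => φ j := by
  refine Submodule.eq_starProjection_of_mem_of_inner_eq_zero (fockVector_mem_fockSubspace _)
    fun ψ hψ => ?_
  obtain ⟨x, rfl⟩ := exists_eq_fockVector hψ
  rw [inner_eq_zero_symm, inner_fockVector_left]
  refine Finset.sum_eq_zero fun j _ => ?_
  rw [lp.coeFn_sub, Pi.sub_apply, fockVector_apply, dif_pos j.2, sub_self, mul_zero]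

theorem norm_sq_sub_starProjection (N : ℕ) (φ : FockSpace) :
    ‖φ - (fockSubspace N).starProjection φ‖ ^ 2 = ‖φ‖ ^ 2 - ∑ i : Fin (N + 1), ‖φ i‖ ^ 2 := by
  have h := Submodule.norm_sq_eq_add_norm_sq_starProjection φ (fockSubspace N)
  rw [Submodule.starProjection_orthogonal_val, starProjection_fockSubspace,
    norm_sq_fockVector] at h
  rw [starProjection_fockSubspace]
  linarith

theorem tendsto_norm_sq_sub_starProjection (φ : FockSpace) :
    Filter.Tendsto (fun N => ‖φ - (fockSubspace N).starProjection φ‖ ^ 2) Filter.atTop (𝓝 0) := by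
  have h : HasSum (fun i => ‖φ i‖ ^ 2) (‖φ‖ ^ 2) := by
    simpa using lp.hasSum_norm (p := 2) (by norm_num) φ
  have h1 := (h.tendsto_sum_nat.comp (Filter.tendsto_add_atTop_nat 1)).const_sub (‖φ‖ ^ 2)
  rw [sub_self] at h1
  refine h1.congr fun N => ?_
  rw [norm_sq_sub_starProjection, Function.comp_apply, Finset.sum_range]

theorem succ_mul_enorm_sub_starProjection_le_energy (N : ℕ) (φ : FockSpace) :
    (N + 1) * ‖φ - (fockSubspace N).starProjection φ‖ₑ ^ 2 ≤ energy φ := by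
  rw [energy_eq_tsum_enorm, ← tsum_enorm_sq, ← ENNReal.tsum_mul_left]
  refine ENNReal.tsum_le_tsum fun n => ?_
  rw [starProjection_fockSubspace, lp.coeFn_sub, Pi.sub_apply, fockVector_apply]
  split_ifs with h
  · simp
  · rw [sub_zero]
    gcongr
    exact_mod_cast not_lt.1 h

theorem truncation_mulVec (U : FockSpace ≃ₗᵢ[ℂ] FockSpace) (N M : ℕ) (x : Fin (M + 1) → ℂ)
    (i : Fin (N + 1)) : (truncation U N M).mulVec x i = U (fockVector x) i := by
  rw [← inner_ket, fockVector, map_sum, inner_sum]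
  simp [Matrix.mulVec, dotProduct, truncation, inner_smul_right, inner_ket, mul_comm]

theorem starProjection_apply_fockVector (U : FockSpace ≃ₗᵢ[ℂ] FockSpace) (N : ℕ) {M : ℕ}
    (x : Fin (M + 1) → ℂ) :
    (fockSubspace N).starProjection (U (fockVector x)) =
      fockVector ((truncation U N M).mulVec x) := by
  simp_rw [starProjection_fockSubspace, ← truncation_mulVec]

theorem norm_sum_smul_sq_le {ι 𝕜 V : Type*} [NormedField 𝕜] [SeminormedAddCommGroup V]
    [NormedSpace 𝕜 V] (s : Finset ι) (x : ι → 𝕜) (v : ι → V) :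
    ‖∑ j ∈ s, x j • v j‖ ^ 2 ≤ (∑ j ∈ s, ‖x j‖ ^ 2) * ∑ j ∈ s, ‖v j‖ ^ 2 := by
  calc ‖∑ j ∈ s, x j • v j‖ ^ 2 ≤ (∑ j ∈ s, ‖x j‖ * ‖v j‖) ^ 2 := by
        gcongr
        exact (norm_sum_le _ _).trans (Finset.sum_le_sum fun j _ => (norm_smul _ _).le)
    _ ≤ _ := Finset.sum_mul_sq_le_sq_mul_sq _ _ _

/-! ### Energies of images of low-energy states -/

theorem energy_smul (c : ℂ) (ψ : FockSpace) : energy (c • ψ) = ‖c‖ₑ ^ 2 * energy ψ := by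
  simp_rw [energy_eq_tsum_enorm, ← ENNReal.tsum_mul_left, lp.coeFn_smul, Pi.smul_apply,
    enorm_smul, mul_pow, mul_left_comm]

theorem energy_apply_le (U : FockSpace ≃ₗᵢ[ℂ] FockSpace) {x : ℝ} {ψ : FockSpace}
    (hψ : ψ ∈ fockSubspace ⌊x⌋₊) : energy (U ψ) ≤ maximalEnergy U x * ‖ψ‖ₑ ^ 2 := by
  rcases eq_or_ne ψ 0 with rfl | h0
  · simp [energy]
  have hn : (‖ψ‖ : ℂ) ≠ 0 := by simpa using h0
  set φ : FockSpace := (‖ψ‖ : ℂ)⁻¹ • ψ with hφ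
  have hφ1 : ‖φ‖ = 1 := by simp [hφ, norm_smul, h0]
  have hU : energy (U φ) ≤ maximalEnergy U x :=
    le_iSup₂_of_le (f := fun (ψ : FockSpace) (_ : ψ ∈ fockSubspace ⌊x⌋₊ ∧ ‖ψ‖ = 1) =>
      energy (U ψ)) φ ⟨Submodule.smul_mem _ _ hψ, hφ1⟩ le_rfl
  calc energy (U ψ) = energy (U ((‖ψ‖ : ℂ) • φ)) := by rw [hφ, smul_inv_smul₀ hn]
    _ = ‖ψ‖ₑ ^ 2 * energy (U φ) := by
      rw [map_smul, energy_smul, ← ofReal_norm_sq (‖ψ‖ : ℂ), Complex.norm_real, norm_norm,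
        ofReal_norm_sq]
    _ ≤ maximalEnergy U x * ‖ψ‖ₑ ^ 2 := by rw [mul_comm]; gcongr

theorem isSchwartz_ket (j : ℕ) : IsSchwartz (ket j) := by
  intro k
  refine tendsto_const_nhds.congr' ?_
  filter_upwards [Filter.eventually_gt_atTop j] with n hn
  rw [ket_apply, if_neg hn.ne', zero_mul]

theorem IsSchwartz.energy_lt_top {ψ : FockSpace} (hψ : IsSchwartz ψ) : energy ψ < ⊤ := by
  obtain ⟨C, hC⟩ := (hψ 2).norm.bddAbove_range
  have hC' (n : ℕ) : ‖ψ n‖ * (n : ℝ) ^ 2 ≤ C := by simpa using hC (Set.mem_range_self n)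
  have hs : Summable fun n : ℕ => (n : ℝ) * ‖ψ n‖ ^ 2 := by
    refine Summable.of_nonneg_of_le (fun n => by positivity) (fun n => ?_)
      ((Real.summable_one_div_nat_pow.2 one_lt_two).mul_left (C ^ 2))
    rcases Nat.eq_zero_or_pos n with rfl | hn
    · simp
    have hn' : (1 : ℝ) ≤ n := by exact_mod_cast hn
    rw [mul_one_div, le_div_iff₀ (by positivity)]
    calc (n : ℝ) * ‖ψ n‖ ^ 2 * n ^ 2 = ‖ψ n‖ ^ 2 * (n : ℝ) ^ 3 := by ring
      _ ≤ ‖ψ n‖ ^ 2 * (n : ℝ) ^ 4 := by gcongr; norm_num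
      _ = (‖ψ n‖ * (n : ℝ) ^ 2) ^ 2 := by ring
      _ ≤ C ^ 2 := pow_le_pow_left₀ (by positivity) (hC' n) 2
  have he : energy ψ = ∑' n : ℕ, ENNReal.ofReal ((n : ℝ) * ‖ψ n‖ ^ 2) :=
    tsum_congr fun n => by rw [ENNReal.ofReal_mul (Nat.cast_nonneg n), ENNReal.ofReal_natCast]
  rw [he]
  exact hs.tsum_ofReal_lt_top

theorem energy_sum_smul_le {ι : Type*} (s : Finset ι) (x : ι → ℂ) (v : ι → FockSpace) :
    energy (∑ j ∈ s, x j • v j) ≤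
      ENNReal.ofReal (∑ j ∈ s, ‖x j‖ ^ 2) * ∑ j ∈ s, energy (v j) := by
  simp only [energy]
  rw [← Summable.tsum_finsetSum fun _ _ => ENNReal.summable, ← ENNReal.tsum_mul_left]
  refine ENNReal.tsum_le_tsum fun i => ?_
  have hi : (∑ j ∈ s, x j • v j : FockSpace) i = ∑ j ∈ s, x j • v j i := by
    simp_rw [← inner_ket, inner_sum, inner_smul_right, smul_eq_mul]
  rw [hi, ← Finset.mul_sum, ← ENNReal.ofReal_sum_of_nonneg (fun _ _ => sq_nonneg _),
    mul_left_comm, ← ENNReal.ofReal_mul (Finset.sum_nonneg fun _ _ => sq_nonneg _)]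
  gcongr
  exact norm_sum_smul_sq_le _ _ _

theorem IsPhysical.maximalEnergy_lt_top {U : FockSpace ≃ₗᵢ[ℂ] FockSpace} (hU : IsPhysical U)
    (x : ℝ) : maximalEnergy U x < ⊤ := by
  refine lt_of_le_of_lt (b := ∑ j : Fin (⌊x⌋₊ + 1), energy (U (ket j))) ?_
    (ENNReal.sum_lt_top.2 fun j _ => (hU _ (isSchwartz_ket j)).energy_lt_top)
  refine iSup₂_le fun ψ ⟨hψ, hψ1⟩ => ?_
  obtain ⟨y, rfl⟩ := exists_eq_fockVector hψ
  have h := energy_sum_smul_le Finset.univ y fun j => U (ket j)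
  rw [← norm_sq_fockVector, hψ1] at h
  rw [fockVector, map_sum]
  simpa using h

/-- At most the fraction `δ` of `‖U ψ‖²` lies outside `ℋ_N`, for all `ψ ∈ ℋ_M`. -/
def LeakageLE (U : FockSpace ≃ₗᵢ[ℂ] FockSpace) (M N : ℕ) (δ : ℝ) : Prop :=
  ∀ ψ ∈ fockSubspace M, ‖U ψ - (fockSubspace N).starProjection (U ψ)‖ ^ 2 ≤ δ * ‖ψ‖ ^ 2

theorem eventually_leakageLE (U : FockSpace ≃ₗᵢ[ℂ] FockSpace) (M : ℕ) {δ : ℝ} (hδ : 0 < δ) :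
    ∀ᶠ N in Filter.atTop, LeakageLE U M N δ := by
  have h := tendsto_finsetSum (Finset.univ : Finset (Fin (M + 1)))
    fun j _ => tendsto_norm_sq_sub_starProjection (U (ket j))
  rw [Finset.sum_const_zero] at h
  filter_upwards [h.eventually_le_const hδ] with N hN ψ hψ
  obtain ⟨y, rfl⟩ := exists_eq_fockVector hψ
  have hsum : U (fockVector y) - (fockSubspace N).starProjection (U (fockVector y)) =
      ∑ j, y j • (U (ket j) - (fockSubspace N).starProjection (U (ket j))) := by
    simp only [fockVector, map_sum, map_smul, smul_sub, Finset.sum_sub_distrib]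
  rw [hsum, norm_sq_fockVector, mul_comm]
  exact (norm_sum_smul_sq_le _ _ _).trans (by gcongr)

theorem leakageLE_of_maximalEnergy_le {U : FockSpace ≃ₗᵢ[ℂ] FockSpace} {x δ : ℝ} {N : ℕ}
    (hδ : 0 ≤ δ) (h : maximalEnergy U x ≤ ENNReal.ofReal (δ * (N + 1))) :
    LeakageLE U ⌊x⌋₊ N δ := by
  intro ψ hψ
  have h1 := (succ_mul_enorm_sub_starProjection_le_energy N (U ψ)).trans (energy_apply_le U hψ)
  have h2 : ENNReal.ofReal ((N + 1) * ‖U ψ - (fockSubspace N).starProjection (U ψ)‖ ^ 2) ≤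
      ENNReal.ofReal ((N + 1) * (δ * ‖ψ‖ ^ 2)) := by
    calc _ = (N + 1) * ‖U ψ - (fockSubspace N).starProjection (U ψ)‖ₑ ^ 2 := by
          rw [ENNReal.ofReal_mul (by positivity), ofReal_norm_sq]
          norm_cast
      _ ≤ ENNReal.ofReal (δ * (N + 1)) * ‖ψ‖ₑ ^ 2 := h1.trans (by gcongr)
      _ = _ := by rw [← ofReal_norm_sq, ← ENNReal.ofReal_mul (by positivity)]; ring_nf
  rw [ENNReal.ofReal_le_ofReal_iff (by positivity)] at h2
  exact le_of_mul_le_mul_left h2 (by positivity)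

theorem LeakageLE.le_sum_norm_sq_truncation_mulVec {U : FockSpace ≃ₗᵢ[ℂ] FockSpace} {M N : ℕ}
    {δ : ℝ} (h : LeakageLE U M N δ) (y : Fin (M + 1) → ℂ) :
    (1 - δ) * ∑ j, ‖y j‖ ^ 2 ≤ ∑ i, ‖(truncation U N M).mulVec y i‖ ^ 2 := by
  have h1 := h _ (fockVector_mem_fockSubspace y)
  rw [norm_sq_sub_starProjection, U.norm_map, norm_sq_fockVector] at h1
  simp_rw [truncation_mulVec]
  linarith

theorem exists_ne_zero_mulVec_eq_zero {𝕜 : Type*} [Field 𝕜] {n m : ℕ}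
    (A : Matrix (Fin n) (Fin m) 𝕜) (h : n < m) : ∃ y ≠ 0, A.mulVec y = 0 := by
  have hk : LinearMap.ker A.mulVecLin ≠ ⊥ := LinearMap.ker_ne_bot_of_finrank_lt (by simpa using h)
  obtain ⟨y, hy, hy0⟩ := (Submodule.ne_bot_iff _).1 hk
  exact ⟨y, hy0, by simpa using hy⟩

-- `U` cannot squeeze `⌊x⌋ + 1` dimensions into `ℋ_N`: some `U ψ` with `ψ ∈ ℋ_⌊x⌋` avoids `ℋ_N`.
theorem succ_le_maximalEnergy (U : FockSpace ≃ₗᵢ[ℂ] FockSpace) {x : ℝ} {N : ℕ} (hN : N < ⌊x⌋₊) :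
    (N + 1 : ℝ≥0∞) ≤ maximalEnergy U x := by
  obtain ⟨y, hy0, hy⟩ := exists_ne_zero_mulVec_eq_zero (truncation U N ⌊x⌋₊) (by omega)
  have h := (succ_mul_enorm_sub_starProjection_le_energy N _).trans
    (energy_apply_le U (fockVector_mem_fockSubspace y))
  rw [starProjection_apply_fockVector, hy] at h
  simp only [fockVector, Pi.zero_apply, zero_smul, Finset.sum_const_zero, sub_zero] at h
  rw [← fockVector, U.enorm_map] at h
  exact (ENNReal.mul_le_mul_iff_left (by simpa using fockVector_ne_zero hy0) (by finiteness)).1 h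

/-! ### Unitary operators on `ℋ_N` and their completions -/

/-- The Fock basis of `ℋ_N`. -/
noncomputable def fockBasis (N : ℕ) : OrthonormalBasis (Fin (N + 1)) ℂ (fockSubspace N) :=
  OrthonormalBasis.mk (v := fun j => ⟨ket j, ket_mem_fockSubspace j⟩)
    (by
      have ho : Orthonormal ℂ fun j : Fin (N + 1) => ket j :=
        orthonormal_ket.comp _ Fin.val_injective
      rw [orthonormal_iff_ite] at ho ⊢
      exact ho)
    (by
      rintro ⟨ψ, hψ⟩ -
      obtain ⟨x, rfl⟩ := exists_eq_fockVector hψ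
      have : (⟨fockVector x, hψ⟩ : fockSubspace N) =
          ∑ j, x j • (⟨ket j, ket_mem_fockSubspace j⟩ : fockSubspace N) := by
        ext1
        simp [fockVector]
      rw [this]
      exact Submodule.sum_mem _ fun j _ =>
        Submodule.smul_mem _ _ (Submodule.subset_span ⟨j, rfl⟩))

theorem fockBasis_apply {N : ℕ} (j : Fin (N + 1)) :
    fockBasis N j = ⟨ket j, ket_mem_fockSubspace j⟩ := by
  simp [fockBasis]

theorem fockBasis_repr_apply {N : ℕ} (ψ : fockSubspace N) (i : Fin (N + 1)) :
    (fockBasis N).repr ψ i = (ψ : FockSpace) i := by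
  rw [OrthonormalBasis.repr_apply_apply, fockBasis_apply, Submodule.coe_inner, inner_ket]

theorem exists_fockMatrix_eq {N : ℕ} {Q : Matrix (Fin (N + 1)) (Fin (N + 1)) ℂ}
    (hQ : Q ∈ Matrix.unitaryGroup (Fin (N + 1)) ℂ) :
    ∃ VN : fockSubspace N ≃ₗᵢ[ℂ] fockSubspace N, fockMatrix VN = Q := by
  have hL : Matrix.toEuclideanCLM (n := Fin (N + 1)) (𝕜 := ℂ) Q ∈
      unitary (EuclideanSpace ℂ (Fin (N + 1)) →L[ℂ] EuclideanSpace ℂ (Fin (N + 1))) :=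
    Unitary.map_mem (Matrix.toEuclideanCLM (n := Fin (N + 1)) (𝕜 := ℂ)) hQ
  refine ⟨((fockBasis N).repr.trans (Unitary.linearIsometryEquiv ⟨_, hL⟩)).trans
    (fockBasis N).repr.symm, ?_⟩
  ext i j
  rw [fockMatrix, Matrix.of_apply, ← fockBasis_apply, ← fockBasis_repr_apply]
  simp only [LinearIsometryEquiv.trans_apply, LinearIsometryEquiv.apply_symm_apply,
    OrthonormalBasis.repr_self]
  change (Matrix.toEuclideanCLM (n := Fin (N + 1)) (𝕜 := ℂ) Q (EuclideanSpace.single j 1)) i = Q i j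
  simp

theorem directSum_apply {N : ℕ} (VN : fockSubspace N ≃ₗᵢ[ℂ] fockSubspace N)
    (V' : (fockSubspace N)ᗮ ≃ₗᵢ[ℂ] (fockSubspace N)ᗮ) (φ : FockSpace) :
    directSum VN V' φ = (VN ((fockSubspace N).orthogonalProjectionOnto φ) : FockSpace) +
      (V' ((fockSubspace N)ᗮ.orthogonalProjectionOnto φ) : FockSpace) :=
  rfl

theorem norm_directSum_apply {N : ℕ} (VN : fockSubspace N ≃ₗᵢ[ℂ] fockSubspace N)
    (V' : (fockSubspace N)ᗮ ≃ₗᵢ[ℂ] (fockSubspace N)ᗮ) (φ : FockSpace) :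
    ‖directSum VN V' φ‖ = ‖φ‖ := by
  have hadd := norm_add_sq_eq_norm_sq_add_norm_sq_of_inner_eq_zero _ _
    (Submodule.inner_right_of_mem_orthogonal (𝕜 := ℂ)
      (VN ((fockSubspace N).orthogonalProjectionOnto φ)).2
      (V' ((fockSubspace N)ᗮ.orthogonalProjectionOnto φ)).2)
  simp only [← pow_two] at hadd
  rw [← sq_eq_sq₀ (norm_nonneg _) (norm_nonneg _), directSum_apply, hadd, ← Submodule.coe_norm,
    ← Submodule.coe_norm, VN.norm_map, V'.norm_map,
    ← Submodule.norm_sq_eq_add_norm_sq_projection φ (fockSubspace N)]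

theorem directSum_ket {N : ℕ} (VN : fockSubspace N ≃ₗᵢ[ℂ] fockSubspace N)
    (V' : (fockSubspace N)ᗮ ≃ₗᵢ[ℂ] (fockSubspace N)ᗮ) (j : Fin (N + 1)) :
    directSum VN V' (ket j) = fockVector fun i => fockMatrix VN i j := by
  have hproj : (fockSubspace N).orthogonalProjectionOnto (ket j) =
      ⟨ket j, ket_mem_fockSubspace j⟩ :=
    Submodule.orthogonalProjectionOnto_mem_subspace_eq_self
      (⟨ket j, ket_mem_fockSubspace j⟩ : fockSubspace N)
  rw [directSum_apply, hproj, Submodule.orthogonalProjectionOnto_orthogonal_apply_eq_zero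
    (ket_mem_fockSubspace j), map_zero, Submodule.coe_zero, add_zero]
  obtain ⟨x, hx⟩ := exists_eq_fockVector (VN ⟨ket j, ket_mem_fockSubspace j⟩).2
  rw [hx]
  congr 1
  ext i
  rw [fockMatrix, Matrix.of_apply, hx, fockVector_apply, dif_pos i.2]

/-! ### Quality of the QR factor -/

theorem sum_norm_sq_mulVec_of_mem_unitaryGroup {ι 𝕜 : Type*} [Fintype ι] [DecidableEq ι]
    [RCLike 𝕜] {Q : Matrix ι ι 𝕜} (hQ : Q ∈ Matrix.unitaryGroup ι 𝕜) (y : ι → 𝕜) :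
    ∑ i, ‖Q.mulVec y i‖ ^ 2 = ∑ i, ‖y i‖ ^ 2 := by
  have hs (z : ι → 𝕜) : ((∑ i, ‖z i‖ ^ 2 : ℝ) : 𝕜) = star z ⬝ᵥ z := by
    simp [dotProduct, RCLike.conj_mul]
  have h : ((∑ i, ‖Q.mulVec y i‖ ^ 2 : ℝ) : 𝕜) = ((∑ i, ‖y i‖ ^ 2 : ℝ) : 𝕜) := by
    rw [hs, hs, Matrix.star_mulVec, ← Matrix.dotProduct_mulVec, Matrix.mulVec_mulVec,
      ← Matrix.star_eq_conjTranspose, Matrix.mem_unitaryGroup_iff'.1 hQ, Matrix.one_mulVec]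
  exact_mod_cast h

theorem exists_ne_zero_forall_gt_eq_zero_mulVec_eq_zero {𝕜 : Type*} [Field 𝕜] {n m : ℕ}
    (R : Matrix (Fin n) (Fin m) 𝕜) (j : Fin m) :
    ∃ y : Fin m → 𝕜, y ≠ 0 ∧ (∀ b, j < b → y b = 0) ∧
      ∀ a : Fin n, (a : ℕ) < j → R.mulVec y a = 0 := by
  let B : Matrix (Fin m) (Fin m) 𝕜 := Matrix.of fun a b =>
    if h : (a : ℕ) < j ∧ (a : ℕ) < n then R ⟨a, h.2⟩ b else if j < a ∧ a = b then 1 else 0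
  have hB : B.det = 0 := Matrix.det_eq_zero_of_row_eq_zero j fun b => by simp [B]
  obtain ⟨y, hy0, hy⟩ := Matrix.exists_mulVec_eq_zero_iff.2 hB
  refine ⟨y, hy0, fun b hb => ?_, fun a ha => ?_⟩
  · simpa [B, Matrix.mulVec, dotProduct, hb.not_gt, hb] using congrFun hy b
  · have ha' : (⟨a, ha.trans j.2⟩ : Fin m) < j := ha
    simpa [B, Matrix.mulVec, dotProduct, ha'] using congrFun hy ⟨a, ha.trans j.2⟩

theorem le_norm_sq_diag_of_upperTriangular {𝕜 : Type*} [NormedField 𝕜] {n m : ℕ}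
    {R : Matrix (Fin n) (Fin m) 𝕜} (hR : ∀ (i : Fin n) (j : Fin m), (j : ℕ) < i → R i j = 0) {c : ℝ}
    (h : ∀ y, c * ∑ j, ‖y j‖ ^ 2 ≤ ∑ i, ‖R.mulVec y i‖ ^ 2)
    {i : Fin n} {j : Fin m} (hij : (i : ℕ) = j) : c ≤ ‖R i j‖ ^ 2 := by
  obtain ⟨y, hy0, hgt, hlt⟩ := exists_ne_zero_forall_gt_eq_zero_mulVec_eq_zero R j
  have hrow (a : Fin n) (ha : j ≤ (a : ℕ)) : R.mulVec y a = R a j * y j := by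
    rw [Matrix.mulVec, dotProduct]
    refine Finset.sum_eq_single j (fun b _ hb => ?_) fun h => absurd (Finset.mem_univ j) h
    rcases lt_or_gt_of_ne hb with hb | hb
    · rw [hR a b ((Fin.lt_def.1 hb).trans_le ha), zero_mul]
    · rw [hgt b hb, mul_zero]
  have hsum : ∑ a, ‖R.mulVec y a‖ ^ 2 = ‖R i j‖ ^ 2 * ‖y j‖ ^ 2 := by
    rw [Finset.sum_eq_single i (fun a _ ha => ?_)
      fun h => absurd (Finset.mem_univ i) h, hrow i hij.ge, norm_mul, mul_pow]
    rcases lt_or_gt_of_ne (Fin.val_ne_of_ne ha) with ha | ha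
    · rw [hlt a (by omega), norm_zero, sq, zero_mul]
    · rw [hrow a (by omega), hR a j (by omega), zero_mul, norm_zero, sq, zero_mul]
  obtain ⟨b, hb⟩ := Function.ne_iff.1 hy0
  have hpos : 0 < ∑ b, ‖y b‖ ^ 2 := Finset.sum_pos' (fun _ _ => sq_nonneg _)
    ⟨b, Finset.mem_univ b, pow_pos (norm_pos_iff.2 hb) 2⟩
  refine le_of_mul_le_mul_right ((h y).trans ?_) hpos
  rw [hsum]
  gcongr
  exact Finset.single_le_sum (f := fun b => ‖y b‖ ^ 2) (fun b _ => sq_nonneg _) (Finset.mem_univ j)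

theorem norm_sub_sq_le_of_le_norm_inner_sq {𝕜 H : Type*} [RCLike 𝕜] [NormedAddCommGroup H]
    [InnerProductSpace 𝕜 H] {u v : H} (hu : ‖u‖ = 1) (hv : ‖v‖ = 1)
    (hre : 0 ≤ RCLike.re ⟪u, v⟫_𝕜) (him : RCLike.im ⟪u, v⟫_𝕜 = 0) {δ : ℝ}
    (h : 1 - δ ≤ ‖⟪u, v⟫_𝕜‖ ^ 2) : ‖u - v‖ ^ 2 ≤ 2 * δ := by
  have hle : ‖⟪u, v⟫_𝕜‖ ≤ 1 := by simpa [hu, hv] using norm_inner_le_norm (𝕜 := 𝕜) u v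
  have hnorm : ‖⟪u, v⟫_𝕜‖ = RCLike.re ⟪u, v⟫_𝕜 := by
    rw [← sq_eq_sq₀ (norm_nonneg _) hre, RCLike.norm_sq_eq_def, him]
    ring
  rw [norm_sub_sq (𝕜 := 𝕜), hu, hv, ← hnorm]
  nlinarith

theorem norm_sq_sub_directSum_ket_le {U : FockSpace ≃ₗᵢ[ℂ] FockSpace} {M N : ℕ} {δ : ℝ}
    (hU : LeakageLE U M N δ) (hMN : M ≤ N) {VN : fockSubspace N ≃ₗᵢ[ℂ] fockSubspace N}
    (hQR : IsQRFactor (fockMatrix VN) (truncation U N M))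
    (V' : (fockSubspace N)ᗮ ≃ₗᵢ[ℂ] (fockSubspace N)ᗮ) (j : Fin (M + 1)) :
    ‖(toOperator U - directSum VN V') (ket j)‖ ^ 2 ≤ 2 * δ := by
  obtain ⟨hQ, R, hA, hR, hdiag⟩ := hQR
  set i : Fin (N + 1) := ⟨j, by omega⟩
  have hinner : ⟪directSum VN V' (ket j), U (ket j)⟫_ℂ = R i j := by
    have hRA : R = star (fockMatrix VN) * truncation U N M := by
      rw [hA, ← Matrix.mul_assoc, Matrix.mem_unitaryGroup_iff'.1 hQ, Matrix.one_mul]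
    rw [directSum_ket VN V' i, inner_fockVector_left, hRA]
    rfl
  have hlow : 1 - δ ≤ ‖R i j‖ ^ 2 := by
    refine le_norm_sq_diag_of_upperTriangular hR (fun y => ?_) rfl
    rw [← sum_norm_sq_mulVec_of_mem_unitaryGroup hQ, Matrix.mulVec_mulVec, ← hA]
    exact hU.le_sum_norm_sq_truncation_mulVec y
  obtain ⟨hre, him⟩ := hdiag i j rfl
  rw [← hinner] at hlow hre him
  change ‖U (ket j) - directSum VN V' (ket j)‖ ^ 2 ≤ _
  rw [norm_sub_rev]
  exact norm_sub_sq_le_of_le_norm_inner_sq (𝕜 := ℂ) (by rw [norm_directSum_apply, norm_ket])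
    (by rw [U.norm_map, norm_ket]) hre him hlow

theorem norm_apply_fockVector_sq_le {V : Type*} [SeminormedAddCommGroup V] [NormedSpace ℂ V]
    (D : FockSpace →L[ℂ] V) {n : ℕ} (x : Fin n → ℂ) :
    ‖D (fockVector x)‖ ^ 2 ≤ (∑ j : Fin n, ‖D (ket j)‖ ^ 2) * ‖fockVector x‖ ^ 2 := by
  have h : D (fockVector x) = ∑ j, x j • D (ket j) := by simp only [fockVector, map_sum, map_smul]
  rw [h, norm_sq_fockVector, mul_comm]
  exact norm_sum_smul_sq_le _ _ _

theorem norm_apply_sq_le_of_columns {D : FockSpace →L[ℂ] FockSpace} (hD : ‖D‖ ≤ 2) (M : ℕ)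
    (φ : FockSpace) :
    ‖D φ‖ ^ 2 ≤ 2 * (∑ j : Fin (M + 1), ‖D (ket j)‖ ^ 2) * ‖φ‖ ^ 2 +
      8 * ‖φ - (fockSubspace M).starProjection φ‖ ^ 2 := by
  set P := (fockSubspace M).starProjection φ with hP
  have hhead : ‖D P‖ ^ 2 ≤ (∑ j : Fin (M + 1), ‖D (ket j)‖ ^ 2) * ‖φ‖ ^ 2 := by
    have hPφ : ‖P‖ ≤ ‖φ‖ := Submodule.norm_starProjection_apply_le _ φ
    rw [hP, starProjection_fockSubspace] at hPφ ⊢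
    exact (norm_apply_fockVector_sq_le D _).trans <| mul_le_mul_of_nonneg_left
      (pow_le_pow_left₀ (norm_nonneg _) hPφ 2) (Finset.sum_nonneg fun _ _ => sq_nonneg _)
  have hsplit : ‖D φ‖ ≤ ‖D P‖ + 2 * ‖φ - P‖ := by
    calc ‖D φ‖ = ‖D P + D (φ - P)‖ := by rw [← D.map_add, add_sub_cancel]
      _ ≤ _ := (norm_add_le _ _).trans (by gcongr; exact D.le_of_opNorm_le hD _)
  have hsq := pow_le_pow_left₀ (norm_nonneg _) hsplit 2
  nlinarith [sq_nonneg (‖D P‖ - 2 * ‖φ - P‖)]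

theorem enorm_apply_sq_le_of_columns {D : FockSpace →L[ℂ] FockSpace} (hD : ‖D‖ ≤ 2) (M : ℕ)
    (φ : FockSpace) :
    ‖D φ‖ₑ ^ 2 ≤ ENNReal.ofReal (2 * ∑ j : Fin (M + 1), ‖D (ket j)‖ ^ 2) * ‖φ‖ₑ ^ 2 +
      8 / (M + 1) * energy φ := by
  have hreal := norm_apply_sq_le_of_columns hD M φ
  have hc : 0 ≤ ∑ j : Fin (M + 1), ‖D (ket j)‖ ^ 2 := Finset.sum_nonneg fun _ _ => sq_nonneg _
  generalize ∑ j : Fin (M + 1), ‖D (ket j)‖ ^ 2 = c at hreal hc ⊢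
  replace hreal := ENNReal.ofReal_le_ofReal hreal
  rw [ENNReal.ofReal_add (by positivity) (by positivity), ENNReal.ofReal_mul (by positivity),
    ENNReal.ofReal_mul (p := 8) (by norm_num), ENNReal.ofReal_ofNat] at hreal
  simp only [ofReal_norm_sq] at hreal
  refine hreal.trans (add_le_add_right ?_ _)
  rw [ENNReal.mul_comm_div]
  gcongr
  rw [ENNReal.le_div_iff_mul_le (.inl (by simp)) (.inl (by finiteness)), mul_comm]
  exact succ_mul_enorm_sub_starProjection_le_energy M φ

theorem norm_toOperator_le (U : FockSpace ≃ₗᵢ[ℂ] FockSpace) : ‖toOperator U‖ ≤ 1 :=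
  ContinuousLinearMap.opNorm_le_bound _ zero_le_one fun φ => by
    rw [one_mul]; exact (U.norm_map φ).le

theorem norm_directSum_le {N : ℕ} (VN : fockSubspace N ≃ₗᵢ[ℂ] fockSubspace N)
    (V' : (fockSubspace N)ᗮ ≃ₗᵢ[ℂ] (fockSubspace N)ᗮ) : ‖directSum VN V'‖ ≤ 1 :=
  ContinuousLinearMap.opNorm_le_bound _ zero_le_one fun φ => by
    rw [one_mul, norm_directSum_apply]

theorem ecDiamondNorm_sub_directSum_le {U : FockSpace ≃ₗᵢ[ℂ] FockSpace} {E ε : ℝ} {M N : ℕ}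
    (hε : 0 ≤ ε) (hE : 64 * E ≤ ε ^ 2 * (M + 1)) (hMN : M ≤ N)
    (hU : LeakageLE U M N (ε ^ 2 / (32 * (M + 1))))
    {VN : fockSubspace N ≃ₗᵢ[ℂ] fockSubspace N}
    (hQR : IsQRFactor (fockMatrix VN) (truncation U N M))
    (V' : (fockSubspace N)ᗮ ≃ₗᵢ[ℂ] (fockSubspace N)ᗮ) :
    ecDiamondNorm E (ampliatedChannel (toOperator U) - ampliatedChannel (directSum VN V'))
      ≤ ENNReal.ofReal ε := by
  have hA := norm_toOperator_le U
  have hB := norm_directSum_le VN V'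
  have hD : ‖toOperator U - directSum VN V'‖ ≤ 2 := (norm_sub_le _ _).trans (by linarith)
  have hcol : ∑ j : Fin (M + 1), ‖(toOperator U - directSum VN V') (ket j)‖ ^ 2 ≤ ε ^ 2 / 16 := by
    refine (Finset.sum_le_sum fun j _ => norm_sq_sub_directSum_ket_le hU hMN hQR V' j).trans_eq ?_
    rw [Finset.sum_const, Finset.card_univ, Fintype.card_fin, nsmul_eq_mul]
    push_cast
    field_simp
    linarith
  have hen : 8 / (M + 1) * ENNReal.ofReal E ≤ ENNReal.ofReal (ε ^ 2 / 8) := by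
    have h8 : (8 / (M + 1) : ℝ≥0∞) = ENNReal.ofReal (8 / (M + 1)) := by
      rw [ENNReal.ofReal_div_of_pos (by positivity), ENNReal.ofReal_ofNat]
      norm_cast
    rw [h8, ← ENNReal.ofReal_mul (by positivity)]
    refine ENNReal.ofReal_le_ofReal ?_
    rw [div_mul_eq_mul_div, div_le_div_iff₀ (by positivity) (by norm_num)]
    linarith
  calc _ ≤ 2 * (ENNReal.ofReal (2 * (ε ^ 2 / 16)) + 8 / (M + 1) * ENNReal.ofReal E) ^ (1/2 : ℝ) :=
        ecDiamondNorm_sub_le hA hB (fun φ => (enorm_apply_sq_le_of_columns hD M φ).trans <| by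
          gcongr) E
    _ ≤ 2 * ENNReal.ofReal ((ε / 2) ^ 2) ^ (1 / 2 : ℝ) := by
        gcongr
        refine (add_le_add_right hen _).trans ?_
        rw [← ENNReal.ofReal_add (by positivity) (by positivity)]
        exact ENNReal.ofReal_le_ofReal (by linarith)
    _ = ENNReal.ofReal ε := by
        rw [ENNReal.ofReal_rpow_of_nonneg (by positivity) (by norm_num), ← Real.sqrt_eq_rpow,
          Real.sqrt_sq (by positivity), ← ENNReal.ofReal_ofNat, ← ENNReal.ofReal_mul (by norm_num)]
        congr 1
        ring

/-! ### The effective dimension -/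

theorem exists_le_leakageLE (U : FockSpace ≃ₗᵢ[ℂ] FockSpace) (x : ℝ) {δ : ℝ} (hδ : 0 < δ)
    (hδ1 : δ ≤ 1) :
    ∃ N ≥ ⌊x⌋₊, N ≤ ENNReal.ofReal δ⁻¹ * maximalEnergy U x ∧ LeakageLE U ⌊x⌋₊ N δ := by
  have hδ' : ENNReal.ofReal δ⁻¹ ≠ 0 := by simpa using hδ
  rcases eq_or_ne (maximalEnergy U x) ⊤ with he | he
  · obtain ⟨N, hN, hle⟩ := ((Filter.eventually_ge_atTop ⌊x⌋₊).and
      (eventually_leakageLE U ⌊x⌋₊ hδ)).exists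
    exact ⟨N, hN, by simp [he, ENNReal.mul_top hδ'], hle⟩
  obtain ⟨e, he0, he⟩ : ∃ e : ℝ, 0 ≤ e ∧ maximalEnergy U x = ENNReal.ofReal e :=
    ⟨_, ENNReal.toReal_nonneg, (ENNReal.ofReal_toReal he).symm⟩
  have hlt : e < δ * (⌊δ⁻¹ * e⌋₊ + 1) := by
    rw [← div_lt_iff₀' hδ, div_eq_inv_mul]
    exact Nat.lt_floor_add_one _
  refine ⟨⌊δ⁻¹ * e⌋₊, ?_, ?_, leakageLE_of_maximalEnergy_le hδ.le ?_⟩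
  · by_contra! hM
    have h := succ_le_maximalEnergy U hM
    rw [he, ← Nat.cast_add_one, ENNReal.natCast_le_ofReal (by positivity)] at h
    push_cast at h
    nlinarith
  · rw [he, ← ENNReal.ofReal_mul (by positivity), ← ENNReal.ofReal_natCast]
    exact ENNReal.ofReal_le_ofReal (Nat.floor_le (by positivity))
  · rw [he]
    exact ENNReal.ofReal_le_ofReal hlt.le

theorem floor_add_one_le {E ε : ℝ} (hE : 0 ≤ E) (hε : 0 < ε) :
    (⌊64 * E / ε ^ 2⌋₊ + 1 : ℝ) ≤ 65 * (max E (ε ^ 2) / ε ^ 2) := by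
  have hfloor : (⌊64 * E / ε ^ 2⌋₊ : ℝ) ≤ 64 * (E / ε ^ 2) :=
    (Nat.floor_le (by positivity)).trans_eq (mul_div_assoc _ _ _)
  have hE' : E / ε ^ 2 ≤ max E (ε ^ 2) / ε ^ 2 := by gcongr; exact le_max_left _ _
  have h1 : 1 ≤ max E (ε ^ 2) / ε ^ 2 := by
    rw [one_le_div₀ (by positivity)]
    exact le_max_right _ _
  linarith

theorem exists_dimension_forall_ecDiamondNorm_le (U : FockSpace ≃ₗᵢ[ℂ] FockSpace) {E ε : ℝ}
    (hE : 0 ≤ E) (hε : 0 < ε) :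
    ∃ N : ℕ, N ≤ ENNReal.ofReal (2080 * (max E (ε ^ 2) / ε ^ 4)) *
        maximalEnergy U (64 * E / ε ^ 2) ∧
      ∀ VN : fockSubspace N ≃ₗᵢ[ℂ] fockSubspace N,
        IsQRFactor (fockMatrix VN) (truncation U N ⌊64 * E / ε ^ 2⌋₊) →
        ∀ V' : (fockSubspace N)ᗮ ≃ₗᵢ[ℂ] (fockSubspace N)ᗮ,
          ecDiamondNorm E (ampliatedChannel (toOperator U) - ampliatedChannel (directSum VN V'))
            ≤ ENNReal.ofReal ε := by
  rcases le_or_gt 2 ε with h2 | h2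
  · refine ⟨0, by simp, fun VN _ V' => ?_⟩
    exact (ecDiamondNorm_sub_le_two (norm_toOperator_le U) (norm_directSum_le VN V') E).trans
      (by simpa using ENNReal.ofReal_le_ofReal h2)
  set M := ⌊64 * E / ε ^ 2⌋₊
  have hMlt : 64 * E ≤ ε ^ 2 * (M + 1) := by
    rw [← div_le_iff₀' (by positivity)]
    exact (Nat.lt_floor_add_one _).le
  obtain ⟨N, hMN, hN, hleak⟩ := exists_le_leakageLE U (64 * E / ε ^ 2)
    (δ := ε ^ 2 / (32 * (M + 1))) (by positivity) (by
      rw [div_le_one₀ (by positivity)]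
      nlinarith [Nat.cast_nonneg (α := ℝ) M])
  refine ⟨N, hN.trans ?_, fun VN hVN V' =>
    ecDiamondNorm_sub_directSum_le hε.le hMlt hMN hleak hVN V'⟩
  gcongr
  calc (ε ^ 2 / (32 * (M + 1)))⁻¹ = 32 * (M + 1) / ε ^ 2 := by rw [inv_div]
    _ ≤ 32 * (65 * (max E (ε ^ 2) / ε ^ 2)) / ε ^ 2 := by
      gcongr
      exact floor_add_one_le hE hε
    _ = 2080 * (max E (ε ^ 2) / ε ^ 4) := by ring

/-! ### Householder reflectors -/

/-- The elementary reflector `I - τ w w†`. -/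
noncomputable def reflector {n : ℕ} (τ : ℂ) (w : Fin n → ℂ) : Matrix (Fin n) (Fin n) ℂ :=
  1 - τ • Matrix.vecMulVec w (star w)

section Reflector

variable {n : ℕ}

theorem star_reflector (τ : ℂ) (w : Fin n → ℂ) : star (reflector τ w) = reflector (star τ) w := by
  simp [reflector, Matrix.star_eq_conjTranspose, Matrix.conjTranspose_vecMulVec]

theorem reflector_mulVec_apply (τ : ℂ) (w v : Fin n → ℂ) (i : Fin n) :
    (reflector τ w).mulVec v i = v i - τ * (star w ⬝ᵥ v) * w i := by
  rw [reflector, Matrix.sub_mulVec, Matrix.one_mulVec, Matrix.smul_mulVec,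
    Matrix.vecMulVec_mulVec]
  simp only [Pi.sub_apply, Pi.smul_apply, smul_eq_mul, MulOpposite.smul_eq_mul_unop,
    MulOpposite.unop_op]
  ring

theorem reflector_mem_unitaryGroup {τ : ℂ} {w : Fin n → ℂ}
    (h : τ + star τ = τ * star τ * (star w ⬝ᵥ w)) :
    reflector τ w ∈ Matrix.unitaryGroup (Fin n) ℂ := by
  have hw : Matrix.vecMulVec w (star w) * Matrix.vecMulVec w (star w) =
      (star w ⬝ᵥ w) • Matrix.vecMulVec w (star w) := by
    rw [Matrix.vecMulVec_mul_vecMulVec, Matrix.vecMulVec_smul]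
  have hmul : reflector τ w * reflector (star τ) w =
      1 - (τ + star τ - τ * star τ * (star w ⬝ᵥ w)) • Matrix.vecMulVec w (star w) := by
    rw [reflector, reflector, sub_mul, mul_sub, mul_sub, smul_mul_smul_comm, hw]
    simp only [mul_one, one_mul, smul_smul, sub_smul, add_smul, mul_assoc]
    abel
  rw [Matrix.mem_unitaryGroup_iff, star_reflector, hmul, h, sub_self, zero_smul, sub_zero]

end Reflector

section Householder

variable {n : ℕ} (x : Fin n → ℂ) (k : Fin n)

/-- The norm of the entries `k, …, n - 1` of a vector. -/
noncomputable def tailNorm : ℝ :=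
  √(∑ i with k ≤ i, ‖x i‖ ^ 2)

/-- The Householder vector that annihilates the entries of `x` below `k`. -/
noncomputable def householderVector : Fin n → ℂ :=
  fun i => if i < k then 0 else if i = k then x k - tailNorm x k else x i

/-- The scalar of the Householder reflector; it is zero, by `1 / 0 = 0`, exactly if the entries
below `k` vanish and the entry at `k` is real and non-negative. -/
noncomputable def householderScalar : ℂ :=
  1 / ((tailNorm x k : ℂ) * tailNorm x k - tailNorm x k * star (x k))

/-- The unitary matrix whose adjoint annihilates the entries of `x` below `k`, makes the entry at
`k` non-negative and leaves the entries above `k` alone. -/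
noncomputable def householder : Matrix (Fin n) (Fin n) ℂ :=
  reflector (householderScalar x k) (householderVector x k)

theorem tailNorm_sq : tailNorm x k ^ 2 = ‖x k‖ ^ 2 + ∑ i with k < i, ‖x i‖ ^ 2 := by
  rw [tailNorm, Real.sq_sqrt (Finset.sum_nonneg fun _ _ => sq_nonneg _)]
  have hinsert : (Finset.univ.filter fun i => k ≤ i) =
      insert k (Finset.univ.filter fun i => k < i) := by
    ext i
    simp [le_iff_eq_or_lt, eq_comm]
  rw [hinsert, Finset.sum_insert (by simp)]

theorem star_householderVector_dotProduct (v : Fin n → ℂ) :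
    star (householderVector x k) ⬝ᵥ v =
      star (x k - tailNorm x k) * v k + ∑ i with k < i, star (x i) * v i := by
  rw [dotProduct, ← Finset.sum_filter_add_sum_filter_not _ (fun i => k < i), add_comm]
  congr 1
  · rw [Finset.sum_eq_single k]
    · simp [householderVector]
    · intro i hi hik
      have hlt : i < k := lt_of_le_of_ne (not_lt.1 (Finset.mem_filter.1 hi).2) hik
      simp [householderVector, hlt]
    · simp
  · refine Finset.sum_congr rfl fun i hi => ?_
    have hlt : k < i := (Finset.mem_filter.1 hi).2
    simp [householderVector, hlt.not_gt, hlt.ne']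

theorem sum_star_mul_self :
    ∑ i with k < i, star (x i) * x i = (tailNorm x k : ℂ) * tailNorm x k - star (x k) * x k := by
  have hsq := congrArg ((↑) : ℝ → ℂ) (tailNorm_sq x k)
  have hstar (z : ℂ) : star z * z = (‖z‖ : ℂ) ^ 2 := RCLike.conj_mul z
  simp_rw [hstar]
  push_cast at hsq
  linear_combination -hsq

theorem star_householderVector_dotProduct_self :
    star (householderVector x k) ⬝ᵥ x =
      (tailNorm x k : ℂ) * tailNorm x k - tailNorm x k * x k := by
  rw [star_householderVector_dotProduct, sum_star_mul_self, star_sub, Complex.star_def,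
    Complex.conj_ofReal]
  ring

theorem star_householderVector_dotProduct_householderVector :
    star (householderVector x k) ⬝ᵥ householderVector x k =
      2 * (tailNorm x k : ℂ) * tailNorm x k - tailNorm x k * x k - tailNorm x k * star (x k) := by
  have hsum : ∑ i with k < i, star (x i) * householderVector x k i =
      ∑ i with k < i, star (x i) * x i :=
    Finset.sum_congr rfl fun i hi => by
      have hlt : k < i := (Finset.mem_filter.1 hi).2
      simp [householderVector, hlt.not_gt, hlt.ne']
  rw [star_householderVector_dotProduct, hsum, sum_star_mul_self]
  simp only [householderVector, lt_irrefl, if_false, if_true, star_sub, Complex.star_def,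
    Complex.conj_ofReal]
  ring

theorem householder_mem_unitaryGroup : householder x k ∈ Matrix.unitaryGroup (Fin n) ℂ := by
  apply reflector_mem_unitaryGroup
  rw [star_householderVector_dotProduct_householderVector, householderScalar]
  set d : ℂ := (tailNorm x k : ℂ) * tailNorm x k - tailNorm x k * star (x k) with hd
  have hsum : 2 * (tailNorm x k : ℂ) * tailNorm x k - tailNorm x k * x k -
      tailNorm x k * star (x k) = d + star d := by
    simp only [hd, star_sub, star_mul', Complex.star_def, Complex.conj_ofReal, Complex.conj_conj]
    ring
  rw [hsum, star_div₀, star_one]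
  rcases eq_or_ne d 0 with h0 | h0
  · simp [h0]
  · have hstar : star d ≠ 0 := star_ne_zero.2 h0
    field_simp
    ring

theorem eq_tailNorm_of_tailNorm_mul_self_eq
    (h : (tailNorm x k : ℂ) * tailNorm x k = tailNorm x k * x k) : x k = tailNorm x k := by
  rcases mul_eq_mul_left_iff.1 h with h | h
  · exact h.symm
  · have hsum : 0 ≤ ∑ i with k < i, ‖x i‖ ^ 2 := Finset.sum_nonneg fun _ _ => sq_nonneg _
    have hsq := tailNorm_sq x k
    rw [Complex.ofReal_eq_zero.1 h] at hsq ⊢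
    have hxk : ‖x k‖ ^ 2 = 0 := by nlinarith [sq_nonneg ‖x k‖]
    simpa using hxk

variable {x k} in
theorem eq_zero_of_eq_tailNorm (h : x k = tailNorm x k) {i : Fin n} (hi : k < i) : x i = 0 := by
  have hsq := tailNorm_sq x k
  rw [h, Complex.norm_real, Real.norm_eq_abs, sq_abs, left_eq_add,
    Finset.sum_eq_zero_iff_of_nonneg fun _ _ => sq_nonneg _] at hsq
  simpa using hsq i (by simpa using hi)

theorem star_householder_mulVec_self (i : Fin n) :
    (star (householder x k)).mulVec x i =
      if i < k then x i else if i = k then (tailNorm x k : ℂ) else 0 := by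
  rw [householder, star_reflector, reflector_mulVec_apply, star_householderVector_dotProduct_self]
  have hscalar : star (householderScalar x k) =
      1 / ((tailNorm x k : ℂ) * tailNorm x k - tailNorm x k * x k) := by
    simp [householderScalar]
  rw [hscalar]
  rcases eq_or_ne ((tailNorm x k : ℂ) * tailNorm x k - tailNorm x k * x k) 0 with h0 | h0
  · have hxk := eq_tailNorm_of_tailNorm_mul_self_eq x k (sub_eq_zero.1 h0)
    simp only [h0, div_zero, zero_mul, sub_zero]
    split_ifs with hlt heq
    · rfl
    · rw [heq, hxk]
    · exact eq_zero_of_eq_tailNorm hxk (lt_of_le_of_ne (not_lt.1 hlt) (Ne.symm heq))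
  · simp only [one_div_mul_cancel h0, one_mul, householderVector]
    split_ifs with hlt heq
    · ring
    · rw [heq]
      ring
    · ring

theorem star_householder_mulVec_of_eq_zero {v : Fin n → ℂ} (hv : ∀ i, k ≤ i → v i = 0) :
    (star (householder x k)).mulVec v = v := by
  have hdot : star (householderVector x k) ⬝ᵥ v = 0 := by
    rw [star_householderVector_dotProduct, hv k le_rfl, Finset.sum_eq_zero fun i hi => ?_]
    · simp
    · rw [hv i (Finset.mem_filter.1 hi).2.le, mul_zero]
  ext i
  rw [householder, star_reflector, reflector_mulVec_apply, hdot]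
  simp

end Householder

/-- `Q * R = A` is a QR factorization as far as the first `k` columns are concerned: the invariant
of the Householder algorithm. -/
structure IsPartialQR (k : ℕ) {n m : ℕ} (Q : Matrix (Fin n) (Fin n) ℂ)
    (A R : Matrix (Fin n) (Fin m) ℂ) : Prop where
  unitary : Q ∈ Matrix.unitaryGroup (Fin n) ℂ
  mul_eq : Q * R = A
  eq_zero : ∀ (i : Fin n) (j : Fin m), (j : ℕ) < k → (j : ℕ) < i → R i j = 0
  diag : ∀ (i : Fin n) (j : Fin m), (j : ℕ) < k → (i : ℕ) = j → 0 ≤ (R i j).re ∧ (R i j).im = 0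

namespace IsPartialQR

variable {n m : ℕ} {Q : Matrix (Fin n) (Fin n) ℂ} {A R : Matrix (Fin n) (Fin m) ℂ}

theorem zero (A : Matrix (Fin n) (Fin m) ℂ) : IsPartialQR 0 1 A A where
  unitary := one_mem _
  mul_eq := Matrix.one_mul A
  eq_zero _ _ hj := absurd hj (Nat.not_lt_zero _)
  diag _ _ hj := absurd hj (Nat.not_lt_zero _)

theorem isQRFactor (h : IsPartialQR (min n m) Q A R) : IsQRFactor Q A :=
  ⟨h.unitary, R, h.mul_eq.symm, fun i j hji => h.eq_zero i j (by omega) hji,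
    fun i j hij => h.diag i j (by omega) hij⟩

theorem succ {k : ℕ} (h : IsPartialQR k Q A R) (hn : k < n) (hm : k < m) :
    IsPartialQR (k + 1) (Q * householder (fun i => R i ⟨k, hm⟩) ⟨k, hn⟩) A
      (star (householder (fun i => R i ⟨k, hm⟩) ⟨k, hn⟩) * R) := by
  set x : Fin n → ℂ := fun i => R i ⟨k, hm⟩
  set κ : Fin n := ⟨k, hn⟩
  have hU := householder_mem_unitaryGroup x κ
  have hold (i : Fin n) (j : Fin m) (hj : (j : ℕ) < k) : (star (householder x κ) * R) i j = R i j :=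
    congrFun (star_householder_mulVec_of_eq_zero x κ (v := fun i => R i j)
      fun l hl => h.eq_zero l j hj (hj.trans_le hl)) i
  have hnew (i : Fin n) (j : Fin m) (hj : (j : ℕ) = k) : (star (householder x κ) * R) i j =
      if i < κ then x i else if i = κ then (tailNorm x κ : ℂ) else 0 := by
    obtain rfl : j = ⟨k, hm⟩ := Fin.ext hj
    exact star_householder_mulVec_self x κ i
  refine ⟨mul_mem h.unitary hU, ?_, fun i j hj hji => ?_, fun i j hj hij => ?_⟩
  · rw [Matrix.mul_assoc, ← Matrix.mul_assoc (householder x κ), Matrix.mem_unitaryGroup_iff.1 hU,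
      Matrix.one_mul, h.mul_eq]
  · rcases Nat.lt_succ_iff_lt_or_eq.1 hj with hj | hj
    · rw [hold i j hj]
      exact h.eq_zero i j hj hji
    · have hlt : κ < i := Fin.lt_def.2 (hj.symm.trans_lt hji)
      rw [hnew i j hj, if_neg hlt.not_gt, if_neg hlt.ne']
  · rcases Nat.lt_succ_iff_lt_or_eq.1 hj with hj | hj
    · rw [hold i j hj]
      exact h.diag i j hj hij
    · have heq : i = κ := Fin.ext (hij.trans hj)
      rw [hnew i j hj, heq, if_neg (lt_irrefl _), if_pos rfl]
      exact ⟨by rw [Complex.ofReal_re]; exact Real.sqrt_nonneg _, Complex.ofReal_im _⟩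

end IsPartialQR

/-- The Householder algorithm: after `k ≤ min n m` reflections, the factors `Q` and `R` with
`Q * R = A` and with the first `k` columns of `R` reduced. -/
noncomputable def householderQR {n m : ℕ} (A : Matrix (Fin n) (Fin m) ℂ) :
    ℕ → Matrix (Fin n) (Fin n) ℂ × Matrix (Fin n) (Fin m) ℂ
  | 0 => (1, A)
  | k + 1 =>
    if h : k < n ∧ k < m then
      let H := householder (fun i => (householderQR A k).2 i ⟨k, h.2⟩) ⟨k, h.1⟩
      ((householderQR A k).1 * H, star H * (householderQR A k).2)
    else householderQR A k

/-- The unitary factor computed by the Householder algorithm. -/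
noncomputable def householderFactor {n m : ℕ} (A : Matrix (Fin n) (Fin m) ℂ) :
    Matrix (Fin n) (Fin n) ℂ :=
  (householderQR A (min n m)).1

section HouseholderQR

variable {n m : ℕ} (A : Matrix (Fin n) (Fin m) ℂ)

theorem householderQR_succ {k : ℕ} (hn : k < n) (hm : k < m) :
    householderQR A (k + 1) =
      ((householderQR A k).1 * householder (fun i => (householderQR A k).2 i ⟨k, hm⟩) ⟨k, hn⟩,
        star (householder (fun i => (householderQR A k).2 i ⟨k, hm⟩) ⟨k, hn⟩) *
          (householderQR A k).2) :=
  dif_pos ⟨hn, hm⟩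

theorem isPartialQR_householderQR {k : ℕ} (hk : k ≤ min n m) :
    IsPartialQR k (householderQR A k).1 A (householderQR A k).2 := by
  induction k with
  | zero => exact .zero A
  | succ k ih =>
    rw [householderQR_succ A (by omega) (by omega)]
    exact (ih (by omega)).succ (by omega) (by omega)

theorem isQRFactor_householderFactor : IsQRFactor (householderFactor A) A :=
  (isPartialQR_householderQR A le_rfl).isQRFactor

end HouseholderQR

/-! ### Reasoning about programs -/

/-- `t` agrees with `s` on the registers `0, …, r - 1` and on the arrays outside `S`. -/
structure Store.EqOff (r : ℕ) (S : Set ℕ) (s t : Store) : Prop where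
  reg : ∀ y < r, t.reg y = s.reg y
  mem : ∀ b ∉ S, t.mem b = s.mem b

namespace Store.EqOff

variable {r r' x v a i j : ℕ} {z : ℂ} {S S' : Set ℕ} {s t u : Store}

theorem refl (r : ℕ) (S : Set ℕ) (s : Store) : EqOff r S s s :=
  ⟨fun _ _ => rfl, fun _ _ => rfl⟩

theorem trans (h : EqOff r S s t) (h' : EqOff r S t u) : EqOff r S s u :=
  ⟨fun y hy => (h'.reg y hy).trans (h.reg y hy), fun b hb => (h'.mem b hb).trans (h.mem b hb)⟩

theorem mono (h : EqOff r S s t) (hr : r' ≤ r) (hS : S ⊆ S') : EqOff r' S' s t :=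
  ⟨fun y hy => h.reg y (hy.trans_le hr), fun b hb => h.mem b fun hb' => hb (hS hb')⟩

theorem setReg (h : EqOff r S s t) (hx : r ≤ x) : EqOff r S s (t.setReg x v) :=
  ⟨fun y hy => by simpa [Store.setReg, (hy.trans_le hx).ne] using h.reg y hy, h.mem⟩

theorem setMem (h : EqOff r S s t) (ha : a ∈ S) : EqOff r S s (t.setMem a i j z) :=
  ⟨h.reg, fun b hb => by
    have hba : b ≠ a := fun hba => hb (hba ▸ ha)
    simpa [Store.setMem, hba] using h.mem b hb⟩

end Store.EqOff

theorem Store.setReg_reg_self (s : Store) (x v : ℕ) : (s.setReg x v).reg x = v := by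
  simp [Store.setReg]

theorem Store.setMem_mem_self (s : Store) (a i j : ℕ) (z : ℂ) :
    (s.setMem a i j z).mem a i j = z := by
  simp [Store.setMem]

theorem Store.setMem_mem_of_not {s : Store} {a i j x y : ℕ} {z : ℂ} (h : ¬(x = i ∧ y = j)) :
    (s.setMem a i j z).mem a x y = s.mem a x y := by
  simp [Store.setMem, h]

/-- The Hoare triple with costs: started in the store `s`, the program `c` takes at most `n` steps
and ends in a store that satisfies `Q`. -/
def Program.Runs (c : Program) (s : Store) (n : ℕ) (Q : Store → Prop) : Prop :=
  Q (c.exec s).1 ∧ (c.exec s).2 ≤ n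

namespace Program

variable {c d : Program} {s : Store} {m n : ℕ} {Q R : Store → Prop}

theorem Runs.of_le (h : c.Runs s m Q) (hn : m ≤ n) : c.Runs s n Q :=
  ⟨h.1, h.2.trans hn⟩

theorem Runs.imp (h : c.Runs s n R) (hQ : ∀ t, R t → Q t) : c.Runs s n Q :=
  ⟨hQ _ h.1, h.2⟩

theorem Runs.seq (hc : c.Runs s m R) (hd : ∀ t, R t → d.Runs t n Q) :
    (c.seq d).Runs s (m + n) Q :=
  ⟨(hd _ hc.1).1, Nat.add_le_add hc.2 (hd _ hc.1).2⟩

theorem Runs.assign_seq {x : ℕ} {e : IndexExpr} (h : d.Runs (s.setReg x (e.eval s)) n Q) :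
    ((assign x e).seq d).Runs s (e.size + 1 + n) Q :=
  ⟨h.1, Nat.add_le_add_left h.2 _⟩

theorem runs_store {a : ℕ} {i j : IndexExpr} {e : ScalarExpr}
    (h : Q (s.setMem a (i.eval s) (j.eval s) (e.eval s))) :
    (store a i j e).Runs s (i.size + j.size + e.size + 1) Q :=
  ⟨h, le_rfl⟩

theorem Runs.store_seq {a : ℕ} {i j : IndexExpr} {e : ScalarExpr}
    (h : d.Runs (s.setMem a (i.eval s) (j.eval s) (e.eval s)) n Q) :
    ((store a i j e).seq d).Runs s (i.size + j.size + e.size + 1 + n) Q :=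
  ⟨h.1, Nat.add_le_add_left h.2 _⟩

theorem runs_loop {x k : ℕ} {e : IndexExpr} (I : ℕ → Store → Prop) (he : e.eval s = k)
    (h0 : I 0 s) (hI : ∀ l < k, ∀ t, I l t → c.Runs (t.setReg x l) n (I (l + 1))) :
    (loop x e c).Runs s (k * (n + 1) + e.size + 1) (I k) := by
  suffices h : ∀ l ≤ k, I l (iterate (fun l t => c.exec (t.setReg x l)) l s).1 ∧
      (iterate (fun l t => c.exec (t.setReg x l)) l s).2 ≤ l * (n + 1) by
    obtain ⟨hQ, hn⟩ := h k le_rfl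
    simp only [Runs, exec, he]
    exact ⟨hQ, by omega⟩
  intro l hl
  induction l with
  | zero => exact ⟨h0, le_of_eq_of_le rfl (Nat.zero_le _)⟩
  | succ l ih =>
    obtain ⟨hQ, hn⟩ := ih (by omega)
    obtain ⟨hQ', hn'⟩ := hI l hl _ hQ
    refine ⟨hQ', ?_⟩
    simp only [iterate, Nat.succ_mul]
    omega

end Program

/-- Sum the scalar `g` over the values `0, …, e - 1` of register 5 into entry `(0, 0)` of the
scratch array 4. -/
def sumLoop (e : IndexExpr) (g : ScalarExpr) : Program :=
  .seq (.store 4 (.const 0) (.const 0) (.const 0))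
    (.loop 5 e (.store 4 (.const 0) (.const 0) (.add (.read 4 (.const 0) (.const 0)) g)))

theorem IndexExpr.eval_setMem (s : Store) (a i j : ℕ) (z : ℂ) (e : IndexExpr) :
    e.eval (s.setMem a i j z) = e.eval s := by
  induction e with
  | const n => rfl
  | var x => rfl
  | add e f he hf => simp only [IndexExpr.eval, he, hf]
  | sub e f he hf => simp only [IndexExpr.eval, he, hf]

theorem runs_sumLoop {e : IndexExpr} {g : ScalarExpr} {s : Store} {n : ℕ} (G : ℕ → ℂ)
    (he : e.eval s = n) (hg : ∀ t, s.EqOff 5 {4} t → g.eval t = G (t.reg 5)) :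
    (sumLoop e g).Runs s (n * (g.size + 8) + e.size + 5) fun t =>
      s.EqOff 5 {4} t ∧ t.mem 4 0 0 = ∑ i ∈ Finset.range n, G i := by
  refine (Program.Runs.store_seq (Program.runs_loop (n := g.size + 7)
    (fun k t => s.EqOff 5 {4} t ∧ t.mem 4 0 0 = ∑ i ∈ Finset.range k, G i)
    (by rw [IndexExpr.eval_setMem, he]) ⟨(Store.EqOff.refl 5 {4} s).setMem rfl, ?_⟩ ?_)).of_le ?_
  · simp [IndexExpr.eval, ScalarExpr.eval, Store.setMem]
  · rintro k - t ⟨hst, hsum⟩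
    have hst' : s.EqOff 5 {4} (t.setReg 5 k) := hst.setReg le_rfl
    refine (Program.runs_store ⟨hst'.setMem rfl, ?_⟩).of_le ?_
    · simp only [ScalarExpr.size, IndexExpr.size]
      omega
    · rw [Finset.sum_range_succ, ← hsum]
      simp only [ScalarExpr.eval, hg _ hst', Store.setReg_reg_self]
      exact Store.setMem_mem_self ..
  · simp only [ScalarExpr.size, IndexExpr.size]
    linarith

/-- Store the scalar `g` at the entry `(u, v)` of array `a`, for the values `0, …, e - 1` of
register 5. -/
def updateLoop (a : ℕ) (u v e : IndexExpr) (g : ScalarExpr) : Program :=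
  .loop 5 e (.store a u v g)

theorem runs_updateLoop {a n : ℕ} {u v e : IndexExpr} {g : ScalarExpr} {s : Store}
    (p q : ℕ → ℕ) (G : ℕ → ℂ) (he : e.eval s = n)
    (hu : ∀ t, s.EqOff 5 {a} t → u.eval t = p (t.reg 5))
    (hv : ∀ t, s.EqOff 5 {a} t → v.eval t = q (t.reg 5))
    (hp : p.Injective)
    (hg : ∀ t, s.EqOff 5 {a} t →
      t.mem a (p (t.reg 5)) (q (t.reg 5)) = s.mem a (p (t.reg 5)) (q (t.reg 5)) →
      g.eval t = G (t.reg 5)) :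
    (updateLoop a u v e g).Runs s (n * (u.size + v.size + g.size + 2) + e.size + 1) fun t =>
      s.EqOff 5 {a} t ∧ (∀ i < n, t.mem a (p i) (q i) = G i) ∧
      ∀ x y, (∀ i < n, ¬(x = p i ∧ y = q i)) → t.mem a x y = s.mem a x y := by
  refine Program.runs_loop (fun k t => s.EqOff 5 {a} t ∧ (∀ i < k, t.mem a (p i) (q i) = G i) ∧
      ∀ x y, (∀ i < k, ¬(x = p i ∧ y = q i)) → t.mem a x y = s.mem a x y) he
    ⟨.refl 5 {a} s, fun i hi => absurd hi (Nat.not_lt_zero i), fun _ _ _ => rfl⟩ ?_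
  rintro k - t ⟨hst, hdone, hrest⟩
  have hst' : s.EqOff 5 {a} (t.setReg 5 k) := hst.setReg le_rfl
  have hreg : (t.setReg 5 k).reg 5 = k := t.setReg_reg_self 5 k
  have hpk {i : ℕ} (hi : i < k) : p k ≠ p i := fun h => hi.ne' (hp h)
  have hgk : g.eval (t.setReg 5 k) = G k := by
    rw [hg _ hst' (by rw [hreg]; exact hrest _ _ fun i hi h => hpk hi h.1), hreg]
  refine Program.runs_store ?_
  rw [hu _ hst', hv _ hst', hgk, hreg]
  refine ⟨hst'.setMem rfl, fun i hi => ?_, fun x y hxy => ?_⟩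
  · rcases Nat.lt_succ_iff_lt_or_eq.1 hi with hi | rfl
    · rw [Store.setMem_mem_of_not fun h => hpk hi h.1.symm]
      exact hdone i hi
    · exact Store.setMem_mem_self ..
  · rw [Store.setMem_mem_of_not (hxy k (Nat.lt_succ_self k))]
    exact hrest x y fun i hi => hxy i (hi.trans (Nat.lt_succ_self k))

/-! ### The factorization program -/

/-- The leading `n × m` block of array `a`. -/
def Store.matrix (s : Store) (a n m : ℕ) : Matrix (Fin n) (Fin m) ℂ :=
  Matrix.of fun i j => s.mem a i j

/-- The leading `n` entries of column `k` of array `a`. -/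
def Store.column (s : Store) (a n k : ℕ) : Fin n → ℂ :=
  fun i => s.mem a i k

theorem Store.EqOff.column_eq {r a n k : ℕ} {S : Set ℕ} {s t : Store} (h : s.EqOff r S t)
    (ha : a ∉ S) : t.column a n k = s.column a n k :=
  funext fun i => congrFun₂ (h.mem a ha) i k

theorem Store.EqOff.matrix_eq {r a n m : ℕ} {S : Set ℕ} {s t : Store} (h : s.EqOff r S t)
    (ha : a ∉ S) : t.matrix a n m = s.matrix a n m :=
  Matrix.ext fun i j => congrFun₂ (h.mem a ha) i j

/-- The number `N + 1` of rows of the input matrix. -/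
def rowCount : IndexExpr :=
  .add (.var 0) (.const 1)

/-- Apply the reflector with scalar `τ` and with vector the column in register 3 of array `a` to
the column in register 4 of array `b`. -/
def reflectColumn (a b : ℕ) (τ : ScalarExpr) : Program :=
  .seq (sumLoop rowCount (.mul (.conj (.read a (.var 5) (.var 3))) (.read b (.var 5) (.var 4))))
    (updateLoop b (.var 5) (.var 4) rowCount (.sub (.read b (.var 5) (.var 4))
      (.mul (.mul τ (.read 4 (.const 0) (.const 0))) (.read a (.var 5) (.var 3)))))

/-- Apply the reflector with scalar `τ` and with vector the column in register 3 of array `a` to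
the first `e` columns of array `b`. -/
def applyReflector (a b : ℕ) (e : IndexExpr) (τ : ScalarExpr) : Program :=
  .loop 4 e (reflectColumn a b τ)

section ApplyReflector

variable {a b N k : ℕ} {τ : ScalarExpr} {z : ℂ} {s : Store}

theorem runs_reflectColumn {j : ℕ} (ha : a ∉ ({b, 4} : Set ℕ)) (hb : b ≠ 4) (hN : s.reg 0 = N)
    (hk : s.reg 3 = k) (hj : s.reg 4 = j) (hτ : ∀ t, s.EqOff 4 {b, 4} t → τ.eval t = z) :
    (reflectColumn a b τ).Runs s ((N + 1) * (τ.size + 44)) fun t => s.EqOff 4 {b, 4} t ∧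
      t.column b (N + 1) j =
        (reflector z (s.column a (N + 1) k)).mulVec (s.column b (N + 1) j) ∧
      ∀ x y, y ≠ j → t.mem b x y = s.mem b x y := by
  have hrow {S : Set ℕ} {t : Store} (ht : s.EqOff 5 S t) : rowCount.eval t = N + 1 := by
    simp [rowCount, IndexExpr.eval, ht.reg, hN]
  have hb4 : b ∉ ({4} : Set ℕ) := hb
  have ha4 : a ∉ ({4} : Set ℕ) := fun h => ha (Or.inr h)
  refine ((runs_sumLoop (n := N + 1) (fun i => star (s.mem a i k) * s.mem b i j)
    (hrow (.refl 5 ∅ s)) fun t ht => ?_).seq fun t₁ ⟨ht₁, hsum⟩ =>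
    ((runs_updateLoop (n := N + 1) id (fun _ => j)
      (fun i => s.mem b i j - z * t₁.mem 4 0 0 * s.mem a i k) (hrow ht₁)
      (fun _ _ => rfl) (fun t ht => ?_) Function.injective_id fun t ht hcur => ?_).imp
      fun t ⟨ht, hnew, hold⟩ => ⟨?_, ?_, fun x y hy => ?_⟩)).of_le ?_
  · simp [ScalarExpr.eval, IndexExpr.eval, ht.reg, ht.mem _ ha4, ht.mem _ hb4, hk, hj]
  · simp [IndexExpr.eval, ht.reg, ht₁.reg, hj]
  · have hst : s.EqOff 5 {b, 4} t :=
      (ht₁.mono le_rfl (by simp)).trans (ht.mono le_rfl (by simp))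
    simp only [id] at hcur
    simp [ScalarExpr.eval, IndexExpr.eval, hst.reg, hst.mem _ ha, hk, hj,
      hτ t (hst.mono (by omega) le_rfl), hcur, ht₁.mem _ hb4, ht.mem 4 hb.symm]
  · simp only [ScalarExpr.size, IndexExpr.size, rowCount]
    nlinarith
  · exact ((ht₁.mono le_rfl (by simp)).trans (ht.mono le_rfl (by simp))).mono (by omega) le_rfl
  · have hdot : star (s.column a (N + 1) k) ⬝ᵥ s.column b (N + 1) j = t₁.mem 4 0 0 := by
      rw [hsum, ← Fin.sum_univ_eq_sum_range]
      rfl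
    ext i
    rw [reflector_mulVec_apply, hdot]
    exact hnew i i.2
  · rw [hold x y fun i _ h => hy h.2, ht₁.mem _ hb4]

theorem runs_applyReflector {m : ℕ} {e : IndexExpr} (ha : a ∉ ({b, 4} : Set ℕ)) (hb : b ≠ 4)
    (hN : s.reg 0 = N) (hk : s.reg 3 = k) (he : e.eval s = m)
    (hτ : ∀ t, s.EqOff 4 {b, 4} t → τ.eval t = z) :
    (applyReflector a b e τ).Runs s (m * ((N + 1) * (τ.size + 44) + 1) + e.size + 1) fun t =>
      s.EqOff 4 {b, 4} t ∧ t.matrix b (N + 1) m =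
        reflector z (s.column a (N + 1) k) * s.matrix b (N + 1) m := by
  refine (Program.runs_loop (fun l t => s.EqOff 4 {b, 4} t ∧ ∀ j, t.column b (N + 1) j =
      if j < l then (reflector z (s.column a (N + 1) k)).mulVec (s.column b (N + 1) j)
      else s.column b (N + 1) j) he ⟨.refl 4 _ s, fun j => by simp⟩ ?_).imp ?_
  · rintro l - t ⟨ht, hcol⟩
    have ht' : s.EqOff 4 {b, 4} (t.setReg 4 l) := ht.setReg le_rfl
    refine (runs_reflectColumn ha hb ((ht'.reg 0 (by omega)).trans hN)
      ((ht'.reg 3 (by omega)).trans hk) (Store.setReg_reg_self ..)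
      fun u hu => hτ u (ht'.trans hu)).imp fun u ⟨hu, hnew, hold⟩ => ⟨ht'.trans hu, fun j => ?_⟩
    rcases lt_trichotomy j l with hj | rfl | hj
    · rw [if_pos (by omega), ← (hcol j).trans (if_pos hj)]
      exact funext fun i => hold i j hj.ne
    · rw [if_pos (Nat.lt_succ_self j), hnew, ← (hcol j).trans (if_neg (lt_irrefl j))]
      exact congrArg₂ _ (congrArg _ (ht'.column_eq ha)) rfl
    · rw [if_neg (by omega), ← (hcol j).trans (if_neg hj.asymm)]
      exact funext fun i => hold i j hj.ne'
  · rintro t ⟨ht, hcol⟩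
    refine ⟨ht, Matrix.ext fun i j => ?_⟩
    exact congrFun ((hcol j).trans (if_pos j.2)) i

end ApplyReflector

/-- Store the tail norm of the column in register 3 of array 0 at the entry `(0, 0)` of array 4. -/
def tailNormProgram : Program :=
  .seq (sumLoop (.sub rowCount (.var 3))
      (.mul (.read 0 (.add (.var 3) (.var 5)) (.var 3))
        (.conj (.read 0 (.add (.var 3) (.var 5)) (.var 3)))))
    (.store 4 (.const 0) (.const 0) (.sqrt (.read 4 (.const 0) (.const 0))))

/-- Store the Householder vector of the column in register 3 of array 0 in the same column, assumed
to be zero, of array `a`, given the tail norm at the entry `(0, 0)` of array 4. -/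
def householderVectorProgram (a : ℕ) : Program :=
  .seq (updateLoop a (.add (.var 3) (.var 5)) (.var 3) (.sub rowCount (.var 3))
      (.read 0 (.add (.var 3) (.var 5)) (.var 3)))
    (.store a (.var 3) (.var 3)
      (.sub (.read a (.var 3) (.var 3)) (.read 4 (.const 0) (.const 0))))

/-- Store the Householder scalar of the column in register 3 of array 0 in array 2, given the tail
norm at the entry `(0, 0)` of array 4. -/
def householderScalarProgram : Program :=
  .store 2 (.var 3) (.const 0) (.div (.const 1)
    (.sub (.mul (.read 4 (.const 0) (.const 0)) (.read 4 (.const 0) (.const 0)))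
      (.mul (.read 4 (.const 0) (.const 0)) (.conj (.read 0 (.var 3) (.var 3))))))

/-- Compute the Householder vector, in array `a`, and the Householder scalar, in array 2, of the
column in register 3 of array 0. -/
def householderProgram (a : ℕ) : Program :=
  .seq tailNormProgram (.seq (householderVectorProgram a) householderScalarProgram)

theorem tailNorm_eq_sqrt_sum_range {n : ℕ} (f : ℕ → ℂ) (k : Fin n) :
    tailNorm (fun i : Fin n => f i) k =
      √(∑ i ∈ Finset.range (n - k), f (k + i) * star (f (k + i))).re := by
  have h : ∑ i : Fin n with k ≤ i, ‖f i‖ ^ 2 = ∑ i ∈ Finset.range (n - k), ‖f (k + i)‖ ^ 2 := by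
    rw [← Finset.sum_Ico_eq_sum_range (fun i => ‖f i‖ ^ 2), Finset.sum_filter]
    simp only [Fin.le_def]
    rw [Fin.sum_univ_eq_sum_range (fun i => if (k : ℕ) ≤ i then ‖f i‖ ^ 2 else 0),
      ← Finset.sum_filter]
    congr 1
    ext i
    simp [and_comm]
  rw [tailNorm, h, Complex.re_sum]
  congr 1
  refine Finset.sum_congr rfl fun i _ => ?_
  have : f (k + i) * star (f (k + i)) = (‖f (k + i)‖ : ℂ) ^ 2 := RCLike.mul_conj _
  rw [this]
  norm_cast

section HouseholderProgram

variable {a N : ℕ} {k : Fin (N + 1)} {s : Store}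

theorem runs_tailNormProgram (hN : s.reg 0 = N) (hk : s.reg 3 = k) :
    tailNormProgram.Runs s ((N + 1) * 37) fun t => s.EqOff 5 {4} t ∧
      t.mem 4 0 0 = tailNorm (s.column 0 (N + 1) k) k := by
  refine ((runs_sumLoop (n := N + 1 - k) (fun i => s.mem 0 (k + i) k * star (s.mem 0 (k + i) k))
    (by simp [rowCount, IndexExpr.eval, hN, hk]) fun t ht => ?_).seq fun t ⟨ht, hsum⟩ =>
    Program.runs_store ⟨ht.setMem rfl, ?_⟩).of_le ?_
  · simp [ScalarExpr.eval, IndexExpr.eval, ht.reg, ht.mem, hk]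
  · simp only [ScalarExpr.size, IndexExpr.size, rowCount]
    omega
  · simp only [ScalarExpr.eval, IndexExpr.eval, Store.setMem_mem_self, hsum]
    exact congrArg _ (tailNorm_eq_sqrt_sum_range (fun i => s.mem 0 i k) k).symm

theorem runs_householderVectorProgram (ha : a ∉ ({0, 4} : Set ℕ)) (hN : s.reg 0 = N)
    (hk : s.reg 3 = k) (hz : ∀ i, s.mem a i k = 0)
    (hr : s.mem 4 0 0 = tailNorm (s.column 0 (N + 1) k) k) :
    (householderVectorProgram a).Runs s ((N + 1) * 27) fun t => s.EqOff 5 {a} t ∧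
      t.column a (N + 1) k = householderVector (s.column 0 (N + 1) k) k ∧
      ∀ x y, y ≠ (k : ℕ) → t.mem a x y = s.mem a x y := by
  have ha0 : 0 ∉ ({a} : Set ℕ) := fun h => ha (Or.inl h.symm)
  have ha4 : 4 ∉ ({a} : Set ℕ) := fun h => ha (Or.inr h.symm)
  refine ((runs_updateLoop (n := N + 1 - k) (fun i => k + i) (fun _ => k)
    (fun i => s.mem 0 (k + i) k) (by simp [rowCount, IndexExpr.eval, hN, hk])
    (fun t ht => by simp [IndexExpr.eval, ht.reg, hk])
    (fun t ht => by simp [IndexExpr.eval, ht.reg, hk]) (add_right_injective _)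
    fun t ht _ => by simp [ScalarExpr.eval, IndexExpr.eval, ht.reg, ht.mem _ ha0, hk]).seq
    fun t ⟨ht, hnew, hold⟩ => Program.runs_store ⟨ht.setMem rfl, ?_⟩).of_le ?_
  · simp only [ScalarExpr.size, IndexExpr.size, rowCount]
    omega
  simp only [ScalarExpr.eval, IndexExpr.eval, ht.reg 3 (by omega), hk, ht.mem 4 ha4, hr]
  refine ⟨funext fun i => ?_, fun x y hy => ?_⟩
  · rw [householderVector, Store.column]
    rcases lt_trichotomy i k with hi | rfl | hi
    · rw [if_pos hi, Store.setMem_mem_of_not fun h => hi.ne (Fin.ext h.1),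
        hold _ _ fun l _ h => by omega, hz]
    · rw [if_neg (lt_irrefl i), if_pos rfl, Store.setMem_mem_self]
      exact congrArg (· - _) (hnew 0 (by omega))
    · have hki : (k : ℕ) + (i - k) = i := Nat.add_sub_cancel' (Fin.lt_def.1 hi).le
      rw [if_neg hi.asymm, if_neg hi.ne', Store.setMem_mem_of_not fun h => hi.ne' (Fin.ext h.1)]
      have := hnew (i - k) (by omega)
      rwa [hki] at this
  · rw [Store.setMem_mem_of_not fun h => hy h.2]
    exact hold x y fun _ _ h => hy h.2

theorem runs_householderProgram (ha : a ∉ ({0, 2, 4} : Set ℕ)) (hN : s.reg 0 = N)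
    (hk : s.reg 3 = k) (hz : ∀ i, s.mem a i k = 0) :
    (householderProgram a).Runs s ((N + 1) * 85) fun t => s.EqOff 5 {a, 2, 4} t ∧
      t.column a (N + 1) k = householderVector (s.column 0 (N + 1) k) k ∧
      (∀ x y, y ≠ (k : ℕ) → t.mem a x y = s.mem a x y) ∧
      t.mem 2 k 0 = householderScalar (s.column 0 (N + 1) k) k ∧
      ∀ l ≠ (k : ℕ), t.mem 2 l 0 = s.mem 2 l 0 := by
  simp only [Set.mem_insert_iff, Set.mem_singleton_iff, not_or] at ha
  obtain ⟨ha0, ha2, ha4⟩ := ha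
  refine ((runs_tailNormProgram hN hk).seq fun t₁ ⟨ht₁, hr⟩ =>
    (runs_householderVectorProgram (by simp [ha0, ha4]) ((ht₁.reg 0 (by omega)).trans hN)
      ((ht₁.reg 3 (by omega)).trans hk) (fun i => by rw [ht₁.mem a ha4, hz])
      (by rw [hr, ht₁.column_eq (a := 0) (by simp)])).seq fun t₂ ⟨ht₂, hw, hold⟩ =>
    Program.runs_store ?_).of_le ?_
  · simp only [ScalarExpr.size, IndexExpr.size]
    omega
  have hst₂ : s.EqOff 5 {a, 2, 4} t₂ := (ht₁.mono le_rfl (by simp)).trans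
    (ht₂.mono le_rfl (by simp))
  simp only [ScalarExpr.eval, IndexExpr.eval, hst₂.reg 3 (by omega), hk,
    hst₂.mem 0 (by simp [Ne.symm ha0]), ht₂.mem 4 (Ne.symm ha4), hr, Nat.cast_one]
  have hlast (z : ℂ) : t₂.EqOff 5 {2} (t₂.setMem 2 k 0 z) := (Store.EqOff.refl 5 _ t₂).setMem rfl
  refine ⟨hst₂.setMem (by simp), ?_, fun x y hy => ?_, Store.setMem_mem_self .., fun l hl => ?_⟩
  · rw [(hlast _).column_eq ha2, hw, ht₁.column_eq (a := 0) (by simp)]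
  · rw [(hlast _).mem a ha2, hold x y hy, ht₁.mem a ha4]
  · rw [Store.setMem_mem_of_not fun h => hl h.1, ht₂.mem 2 (Ne.symm ha2), ht₁.mem 2 (by simp)]

end HouseholderProgram

/-- The ordered product of the first `m` reflectors, with the vectors read off from the columns of
array `a` and the scalars from array 2. -/
noncomputable def Store.reflectorProduct (s : Store) (a n m : ℕ) : Matrix (Fin n) (Fin n) ℂ :=
  ((List.range m).map fun k => reflector (s.mem 2 k 0) (s.column a n k)).prod

namespace Store

theorem outputReflectors_eq (s : Store) (n m : ℕ) :
    s.outputReflectors n m = s.reflectorProduct 1 n m := rfl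

theorem reflectorProduct_zero (s : Store) (a n : ℕ) : s.reflectorProduct a n 0 = 1 := rfl

theorem reflectorProduct_succ (s : Store) (a n m : ℕ) : s.reflectorProduct a n (m + 1) =
    s.reflectorProduct a n m * reflector (s.mem 2 m 0) (s.column a n m) := by
  simp [reflectorProduct, List.range_succ]

theorem reflectorProduct_congr {s t : Store} {a n m : ℕ}
    (hτ : ∀ k < m, t.mem 2 k 0 = s.mem 2 k 0)
    (hw : ∀ k < m, t.column a n k = s.column a n k) :
    t.reflectorProduct a n m = s.reflectorProduct a n m :=
  congrArg List.prod <| List.map_congr_left fun k hk => by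
    rw [hτ k (List.mem_range.1 hk), hw k (List.mem_range.1 hk)]

theorem reflectorProduct_eq_of_le {s : Store} {a n m m' : ℕ} (h : m ≤ m')
    (hτ : ∀ k, m ≤ k → s.mem 2 k 0 = 0) :
    s.reflectorProduct a n m' = s.reflectorProduct a n m := by
  induction m', h using Nat.le_induction with
  | base => rfl
  | succ k hk ih => simp [reflectorProduct_succ, ih, hτ k hk, reflector]

end Store

/-- Reduce the column in register 3 of array 0: compute its Householder reflector and apply the
adjoint to array 0. -/
def factorStep (a : ℕ) : Program :=
  .seq (householderProgram a)
    (applyReflector a 0 (.add (.var 1) (.const 1)) (.conj (.read 2 (.var 3) (.const 0))))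

/-- Householder QR factorization of the matrix in array 0: the reflection vectors are stored in the
columns of array `a`, the scalars in array 2 and the number of reflectors in register 2. -/
def factorProgram (a : ℕ) : Program :=
  .seq (.assign 2 (.sub rowCount (.sub (.var 0) (.var 1))))
    (.loop 3 (.var 2) (factorStep a))

/-- The loop invariant of `factorProgram`, after `k` reflectors. -/
structure IsFactorState {N M : ℕ} (a k : ℕ) (A : Matrix (Fin (N + 1)) (Fin (M + 1)) ℂ)
    (t : Store) : Prop where
  eqOff : ((inputStore A).setReg 2 (min N M + 1)).EqOff 3 {0, a, 2, 4} t
  reflectorProduct_eq : t.reflectorProduct a (N + 1) k = (householderQR A k).1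
  matrix_eq : t.matrix 0 (N + 1) (M + 1) = (householderQR A k).2
  mem_eq_zero : ∀ i l, k ≤ l → t.mem a i l = 0
  scalar_eq_zero : ∀ l, k ≤ l → t.mem 2 l 0 = 0

namespace IsFactorState

variable {N M a k : ℕ} {A : Matrix (Fin (N + 1)) (Fin (M + 1)) ℂ} {t : Store}

theorem reg_zero (h : IsFactorState a k A t) : t.reg 0 = N := h.eqOff.reg 0 (by omega)

theorem reg_one (h : IsFactorState a k A t) : t.reg 1 = M := h.eqOff.reg 1 (by omega)

theorem reg_two (h : IsFactorState a k A t) : t.reg 2 = min N M + 1 := h.eqOff.reg 2 (by omega)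

theorem zero (ha : a ≠ 0) : IsFactorState a 0 A ((inputStore A).setReg 2 (min N M + 1)) where
  eqOff := .refl ..
  reflectorProduct_eq := rfl
  matrix_eq := Matrix.ext fun i j => dif_pos ⟨rfl, i.2, j.2⟩
  mem_eq_zero _ _ _ := dif_neg fun h => ha h.1
  scalar_eq_zero _ _ := by simp [inputStore, Store.setReg]

theorem setReg (h : IsFactorState a k A t) (v : ℕ) : IsFactorState a k A (t.setReg 3 v) where
  eqOff := h.eqOff.setReg le_rfl
  reflectorProduct_eq := h.reflectorProduct_eq
  matrix_eq := h.matrix_eq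
  mem_eq_zero := h.mem_eq_zero
  scalar_eq_zero := h.scalar_eq_zero

theorem runs_factorStep (ha : a ∉ ({0, 2, 4} : Set ℕ)) (h : IsFactorState a k A t)
    (hk : t.reg 3 = k) (hN : k < N + 1) (hM : k < M + 1) :
    (factorStep a).Runs t ((N + 1) * (M + 1) * 138) (IsFactorState a (k + 1) A) := by
  obtain ⟨ha0, -, ha4⟩ : a ≠ 0 ∧ a ≠ 2 ∧ a ≠ 4 := by simpa using ha
  refine ((runs_householderProgram (k := ⟨k, hN⟩) ha h.reg_zero hk
    fun i => h.mem_eq_zero i k le_rfl).seq fun t₁ ⟨ht₁, hw, hwold, hτ, hτold⟩ =>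
    (runs_applyReflector (z := star (t₁.mem 2 k 0)) (m := M + 1) (by simp [ha0, ha4]) (by omega)
      ((ht₁.reg 0 (by omega)).trans h.reg_zero) ((ht₁.reg 3 (by omega)).trans hk)
      (by simp [IndexExpr.eval, ht₁.reg, h.reg_one]) fun u hu => ?_).imp
    fun u ⟨hu, hmat⟩ => ?_).of_le ?_
  · simp [ScalarExpr.eval, IndexExpr.eval, hu.reg, hu.mem, ht₁.reg, hk]
  · simp only [ScalarExpr.size, IndexExpr.size]
    nlinarith
  have hτu (l : ℕ) : u.mem 2 l 0 = t₁.mem 2 l 0 := congrFun₂ (hu.mem 2 (by simp)) l 0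
  have hau : u.mem a = t₁.mem a := hu.mem a (by simp [ha0, ha4])
  have hprod : u.reflectorProduct a (N + 1) k = t.reflectorProduct a (N + 1) k :=
    Store.reflectorProduct_congr (fun l hl => (hτu l).trans (hτold l hl.ne))
      fun l hl => funext fun i => (congrFun₂ hau i l).trans (hwold i l hl.ne)
  have hQR := householderQR_succ A hN hM
  have hcol : t.column 0 (N + 1) k = fun i => (householderQR A k).2 i ⟨k, hM⟩ := by
    rw [← h.matrix_eq]
    rfl
  rw [hcol] at hw hτ
  refine ⟨h.eqOff.trans ((ht₁.mono (by omega) ?_).trans (hu.mono (by omega) ?_)), ?_, ?_,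
    fun i l hl => ?_, fun l hl => ?_⟩
  · simp
  · simp [Set.insert_subset_iff]
  · rw [Store.reflectorProduct_succ, hprod, hτu, hu.column_eq (by simp [ha0, ha4]), hw, hτ, hQR]
    exact congrArg (· * _) h.reflectorProduct_eq
  · rw [hmat, ht₁.matrix_eq (by simp [ha0.symm]), h.matrix_eq, hw, hτ, hQR, householder,
      star_reflector]
  · rw [hau, hwold i l (Nat.lt_of_succ_le hl).ne', h.mem_eq_zero i l (by omega)]
  · rw [hτu, hτold l (Nat.lt_of_succ_le hl).ne', h.scalar_eq_zero l (by omega)]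

end IsFactorState

theorem runs_factorProgram {a N M : ℕ} (ha : a ∉ ({0, 2, 4} : Set ℕ))
    (A : Matrix (Fin (N + 1)) (Fin (M + 1)) ℂ) :
    (factorProgram a).Runs (inputStore A) ((N + 1) * (M + 1) * (min N M + 1) * 149)
      (IsFactorState a (min N M + 1) A) := by
  have hK : (IndexExpr.sub rowCount (.sub (.var 0) (.var 1))).eval (inputStore A) =
      min N M + 1 := by
    change N + 1 - (N - M) = min N M + 1
    omega
  refine (Program.Runs.assign_seq (Program.runs_loop (IsFactorState a · A) (k := min N M + 1)
    (by rw [hK]; exact Store.setReg_reg_self ..) (by rw [hK]; exact .zero (by simp_all))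
    fun k hk t ht => (ht.setReg k).runs_factorStep ha (Store.setReg_reg_self ..) (by omega)
      (by omega))).of_le ?_
  have hK1 : 1 ≤ min N M + 1 := by omega
  have hle : min N M + 1 ≤ (N + 1) * (M + 1) * (min N M + 1) :=
    Nat.le_mul_of_pos_left _ (by positivity)
  simp only [IndexExpr.size, rowCount]
  generalize min N M + 1 = K, (N + 1) * (M + 1) = L at hK1 hle ⊢
  nlinarith

/-- Multiply out, in array 1, the reflectors computed by `factorProgram 3`, starting with the last
one, so that every reflector acts from the left on the product of those that follow it. -/
def accumulateProgram : Program :=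
  .seq (updateLoop 1 (.var 5) (.var 5) rowCount (.const 1))
    (.loop 3 (.var 2) (.seq (.assign 3 (.sub (.sub (.var 2) (.const 1)) (.var 3)))
      (applyReflector 3 1 rowCount (.read 2 (.var 3) (.const 0)))))

section AccumulateProgram

variable {N K : ℕ} {s : Store}

theorem runs_updateLoop_one (hN : s.reg 0 = N) (hz : ∀ i j, s.mem 1 i j = 0) :
    (updateLoop 1 (.var 5) (.var 5) rowCount (.const 1)).Runs s ((N + 1) * 9) fun t =>
      s.EqOff 5 {1} t ∧ t.matrix 1 (N + 1) (N + 1) = 1 := by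
  refine ((runs_updateLoop (n := N + 1) id id (fun _ => 1) (by simp [rowCount, IndexExpr.eval, hN])
    (fun _ _ => rfl) (fun _ _ => rfl) Function.injective_id
    fun _ _ _ => Nat.cast_one).imp fun t ⟨ht, hnew, hold⟩ => ⟨ht, ?_⟩).of_le ?_
  · simp only [ScalarExpr.size, IndexExpr.size, rowCount]
    omega
  · ext i j
    rcases eq_or_ne i j with rfl | hij
    · rw [Matrix.one_apply_eq]
      exact hnew i i.2
    · rw [Matrix.one_apply_ne hij, ← hz i j]
      exact hold i j fun l _ h => hij (Fin.ext (h.1.trans h.2.symm))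

theorem runs_accumulateProgram (hN : s.reg 0 = N) (hK : s.reg 2 = K)
    (hz : ∀ i j, s.mem 1 i j = 0) :
    accumulateProgram.Runs s ((N + 1) ^ 2 * (K + 1) * 60) fun t =>
      t.outputMatrix (N + 1) = s.reflectorProduct 3 (N + 1) K := by
  refine (((runs_updateLoop_one hN hz).seq fun t₀ ⟨ht₀, hone⟩ => Program.runs_loop
    (e := .var 2) (fun l t => s.EqOff 3 {1, 4} t ∧ s.reflectorProduct 3 (N + 1) (K - l) *
      t.matrix 1 (N + 1) (N + 1) = s.reflectorProduct 3 (N + 1) K)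
    ((ht₀.reg 2 (by omega)).trans hK) ⟨ht₀.mono (by omega) (by simp), by simp [hone]⟩
    (n := 6 + ((N + 1) * ((N + 1) * 47 + 1) + 4)) ?_).imp fun t ⟨_, ht⟩ => ?_).of_le ?_
  · rintro l hl t ⟨ht, hprod⟩
    have hsub : (IndexExpr.sub (.sub (.var 2) (.const 1)) (.var 3)).eval (t.setReg 3 l) =
        K - (l + 1) := by
      have hreg : (t.setReg 3 l).reg 2 = K := (ht.reg 2 (by omega)).trans hK
      simp only [IndexExpr.eval, hreg, Store.setReg_reg_self]
      omega
    refine Program.Runs.assign_seq ?_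
    rw [hsub]
    set t' := (t.setReg 3 l).setReg 3 (K - (l + 1))
    have ht' : s.EqOff 3 {1, 4} t' := (ht.setReg le_rfl).setReg le_rfl
    have hN' : t'.reg 0 = N := (ht'.reg 0 (by omega)).trans hN
    have hreg : t'.reg 3 = K - (l + 1) := Store.setReg_reg_self ..
    refine (runs_applyReflector (z := s.mem 2 (K - (l + 1)) 0) (by simp) (by omega) hN' hreg
      (by simp [rowCount, IndexExpr.eval, hN']) fun u hu => ?_).imp fun u ⟨hu, hmat⟩ =>
        ⟨ht'.trans (hu.mono (by omega) le_rfl), ?_⟩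
    · simp [ScalarExpr.eval, IndexExpr.eval, hu.reg, hreg, hu.mem, ht'.mem]
    · rw [hmat, ← Matrix.mul_assoc, ht'.column_eq (by simp), ← Store.reflectorProduct_succ,
        show K - (l + 1) + 1 = K - l by omega]
      exact hprod
  · simp only [IndexExpr.size]
    have : 0 < (N + 1) ^ 2 := by positivity
    nlinarith [Nat.zero_le (N * K), Nat.zero_le (N ^ 2 * K)]
  · rwa [Nat.sub_self, Store.reflectorProduct_zero, one_mul] at ht

end AccumulateProgram

/-- Compute the unitary factor and all of its entries. -/
def entriesProgram : Program :=
  .seq (factorProgram 3) accumulateProgram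

theorem IsFactorState.reflectorProduct_eq_householderFactor {a N M : ℕ} {t : Store}
    {A : Matrix (Fin (N + 1)) (Fin (M + 1)) ℂ} (h : IsFactorState a (min N M + 1) A t) :
    t.reflectorProduct a (N + 1) (min N M + 1) = householderFactor A := by
  rw [h.reflectorProduct_eq, householderFactor, Nat.add_min_add_right]

section Output

variable {N M : ℕ} (A : Matrix (Fin (N + 1)) (Fin (M + 1)) ℂ)

theorem runs_factorProgram_one : (factorProgram 1).Runs (inputStore A)
    ((N + 1) * (M + 1) ^ 2 * 149) fun t =>
      t.outputReflectors (N + 1) (M + 1) = householderFactor A := by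
  refine ((runs_factorProgram (by simp) A).imp fun t ht => ?_).of_le ?_
  · rw [Store.outputReflectors_eq,
      Store.reflectorProduct_eq_of_le (m := min N M + 1) (by omega) ht.scalar_eq_zero,
      ht.reflectorProduct_eq_householderFactor]
  · have : min N M + 1 ≤ M + 1 := by omega
    rw [sq, ← mul_assoc]
    gcongr

theorem runs_entriesProgram : entriesProgram.Runs (inputStore A)
    ((N + 1) ^ 2 * (M + 1) * 269) fun t => t.outputMatrix (N + 1) = householderFactor A := by
  refine ((runs_factorProgram (by simp) A).seq fun s hs => (runs_accumulateProgram hs.reg_zero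
    hs.reg_two fun i j => ?_).imp fun t ht => ?_).of_le ?_
  · rw [hs.eqOff.mem 1 (by simp)]
    simp [inputStore, Store.setReg]
  · rw [ht, hs.reflectorProduct_eq_householderFactor]
  · have hN : (N + 1) * (M + 1) * (min N M + 1) ≤ (N + 1) * (M + 1) * (N + 1) := by
      gcongr
      omega
    have hM : (N + 1) ^ 2 * (min N M + 1 + 1) ≤ (N + 1) ^ 2 * (2 * (M + 1)) := by
      gcongr
      omega
    linarith

end Output

/-! ### Step counts in terms of the energy -/

section Complexity

variable {N : ℕ} {E ε : ℝ}

theorem time_factorProgram_le (hE : 0 ≤ E) (hε : 0 < ε)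
    (A : Matrix (Fin (N + 1)) (Fin (⌊64 * E / ε ^ 2⌋₊ + 1)) ℂ) :
    ((factorProgram 1).time A : ℝ) ≤ 149 * 65 ^ 2 * ((N + 1) * max E (ε ^ 2) ^ 2 / ε ^ 4) := by
  calc ((factorProgram 1).time A : ℝ) ≤ (N + 1) * (⌊64 * E / ε ^ 2⌋₊ + 1) ^ 2 * 149 := by
        exact_mod_cast (runs_factorProgram_one A).2
    _ ≤ (N + 1) * (65 * (max E (ε ^ 2) / ε ^ 2)) ^ 2 * 149 := by
        gcongr
        exact floor_add_one_le hE hε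
    _ = 149 * 65 ^ 2 * ((N + 1) * max E (ε ^ 2) ^ 2 / ε ^ 4) := by ring

theorem time_entriesProgram_le (hE : 0 ≤ E) (hε : 0 < ε)
    (A : Matrix (Fin (N + 1)) (Fin (⌊64 * E / ε ^ 2⌋₊ + 1)) ℂ) :
    (entriesProgram.time A : ℝ) ≤ 269 * 65 * ((N + 1) ^ 2 * (max E (ε ^ 2) / ε ^ 2)) := by
  calc (entriesProgram.time A : ℝ) ≤ (N + 1) ^ 2 * (⌊64 * E / ε ^ 2⌋₊ + 1) * 269 := by
        exact_mod_cast (runs_entriesProgram A).2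
    _ ≤ (N + 1) ^ 2 * (65 * (max E (ε ^ 2) / ε ^ 2)) * 269 := by
        gcongr
        exact floor_add_one_le hE hε
    _ = 269 * 65 * ((N + 1) ^ 2 * (max E (ε ^ 2) / ε ^ 2)) := by ring

theorem one_le_four_mul_div_pow_four (hε : 0 < ε) (hεE : ε ^ 2 ≤ E) (hε2 : ε ≤ 2) :
    1 ≤ 4 * (E / ε ^ 4) := by
  have h4 : ε ^ 2 ≤ 4 := by nlinarith
  rw [← mul_div_assoc, one_le_div (by positivity)]
  calc ε ^ 4 = ε ^ 2 * ε ^ 2 := by ring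
    _ ≤ 4 * E := mul_le_mul h4 hεE (by positivity) (by norm_num)

variable {U : FockSpace ≃ₗᵢ[ℂ] FockSpace}

theorem one_le_maximalEnergy (hε : 0 < ε) (hεE : ε ^ 2 ≤ E) :
    1 ≤ maximalEnergy U (64 * E / ε ^ 2) := by
  have hx : 0 < ⌊64 * E / ε ^ 2⌋₊ := by
    rw [Nat.floor_pos, le_div_iff₀ (by positivity)]
    nlinarith [sq_nonneg ε]
  simpa using succ_le_maximalEnergy U hx

theorem dimension_add_one_le (hε : 0 < ε) (hεE : ε ^ 2 ≤ E) (hε2 : ε ≤ 2)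
    (hN : (N : ℝ≥0∞) ≤
      ENNReal.ofReal (2080 * (max E (ε ^ 2) / ε ^ 4)) * maximalEnergy U (64 * E / ε ^ 2)) :
    (N + 1 : ℝ≥0∞) ≤ ENNReal.ofReal (2084 * (E / ε ^ 4)) * maximalEnergy U (64 * E / ε ^ 2) := by
  have hE : 0 ≤ E := (sq_nonneg ε).trans hεE
  rw [max_eq_left hεE] at hN
  calc (N + 1 : ℝ≥0∞)
      ≤ ENNReal.ofReal (2080 * (E / ε ^ 4)) * maximalEnergy U (64 * E / ε ^ 2) +
        ENNReal.ofReal (4 * (E / ε ^ 4)) * maximalEnergy U (64 * E / ε ^ 2) :=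
        add_le_add hN (one_le_mul
          (ENNReal.one_le_ofReal.2 (one_le_four_mul_div_pow_four hε hεE hε2))
          (one_le_maximalEnergy hε hεE))
    _ = ENNReal.ofReal (2084 * (E / ε ^ 4)) * maximalEnergy U (64 * E / ε ^ 2) := by
        rw [← add_mul, ← ENNReal.ofReal_add (by positivity) (by positivity)]
        ring_nf

theorem time_factorProgram_le_maximalEnergy (hε : 0 < ε) (hεE : ε ^ 2 ≤ E) (hε2 : ε ≤ 2)
    (hN : (N : ℝ≥0∞) ≤
      ENNReal.ofReal (2080 * (max E (ε ^ 2) / ε ^ 4)) * maximalEnergy U (64 * E / ε ^ 2))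
    (A : Matrix (Fin (N + 1)) (Fin (⌊64 * E / ε ^ 2⌋₊ + 1)) ℂ) :
    ((factorProgram 1).time A : ℝ≥0∞) ≤
      ENNReal.ofReal (149 * 65 ^ 2 * 2084 * (E ^ 3 / ε ^ 8)) *
        maximalEnergy U (64 * E / ε ^ 2) := by
  have hE : 0 ≤ E := (sq_nonneg ε).trans hεE
  have htime : ((factorProgram 1).time A : ℝ) ≤
      149 * 65 ^ 2 * (E ^ 2 / ε ^ 4) * ((N + 1 : ℕ) : ℝ) := by
    refine (time_factorProgram_le hE hε A).trans_eq ?_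
    rw [max_eq_left hεE]
    push_cast
    ring
  calc ((factorProgram 1).time A : ℝ≥0∞)
      ≤ ENNReal.ofReal (149 * 65 ^ 2 * (E ^ 2 / ε ^ 4)) * (N + 1) := by
        rw [← ENNReal.ofReal_natCast]
        refine (ENNReal.ofReal_le_ofReal htime).trans_eq ?_
        rw [ENNReal.ofReal_mul (by positivity), ENNReal.ofReal_natCast, Nat.cast_succ]
    _ ≤ ENNReal.ofReal (149 * 65 ^ 2 * (E ^ 2 / ε ^ 4)) *
        (ENNReal.ofReal (2084 * (E / ε ^ 4)) * maximalEnergy U (64 * E / ε ^ 2)) := by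
        gcongr
        exact dimension_add_one_le hε hεE hε2 hN
    _ = ENNReal.ofReal (149 * 65 ^ 2 * 2084 * (E ^ 3 / ε ^ 8)) *
        maximalEnergy U (64 * E / ε ^ 2) := by
        rw [← mul_assoc, ← ENNReal.ofReal_mul (by positivity)]
        congr 2
        ring

end Complexity

end Bosonic

theorem theorem1_general :
    ∃ (C : ℝ) (P P' : Program), 0 < C ∧
      ∀ U : FockSpace ≃ₗᵢ[ℂ] FockSpace, ∀ E ε : ℝ, 0 ≤ E → 0 < ε →
        ∃ (N : ℕ) (VN : fockSubspace N ≃ₗᵢ[ℂ] fockSubspace N),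
          (N : ℝ≥0∞) ≤
            ENNReal.ofReal (C * (max E (ε ^ 2) / ε ^ 4)) * maximalEnergy U (64 * E / ε ^ 2) ∧
          (∀ V' : (fockSubspace N)ᗮ ≃ₗᵢ[ℂ] (fockSubspace N)ᗮ,
            ecDiamondNorm E
              (ampliatedChannel (toOperator U) - ampliatedChannel (directSum VN V'))
              ≤ ENNReal.ofReal ε) ∧
          IsQRFactor (fockMatrix VN) (truncation U N ⌊64 * E / ε ^ 2⌋₊) ∧
          (P.output (truncation U N ⌊64 * E / ε ^ 2⌋₊)).outputReflectors (N + 1)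
            (⌊64 * E / ε ^ 2⌋₊ + 1) = fockMatrix VN ∧
          (P.time (truncation U N ⌊64 * E / ε ^ 2⌋₊) : ℝ) ≤
            C * ((N + 1) * (max E (ε ^ 2)) ^ 2 / ε ^ 4) ∧
          (ε ^ 2 ≤ E → ε ≤ 2 →
            (P.time (truncation U N ⌊64 * E / ε ^ 2⌋₊) : ℝ≥0∞) ≤
              ENNReal.ofReal (C * (E ^ 3 / ε ^ 8)) * maximalEnergy U (64 * E / ε ^ 2)) ∧
          (P'.output (truncation U N ⌊64 * E / ε ^ 2⌋₊)).outputMatrix (N + 1) = fockMatrix VN ∧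
          (P'.time (truncation U N ⌊64 * E / ε ^ 2⌋₊) : ℝ) ≤
            C * ((N + 1) ^ 2 * (max E (ε ^ 2) / ε ^ 2)) := by
  refine ⟨149 * 65 ^ 2 * 2084, factorProgram 1, entriesProgram, by norm_num, fun U E ε hE hε => ?_⟩
  obtain ⟨N, hN, happrox⟩ := exists_dimension_forall_ecDiamondNorm_le U hE hε
  have hQR := isQRFactor_householderFactor (truncation U N ⌊64 * E / ε ^ 2⌋₊)
  obtain ⟨VN, hVN⟩ := exists_fockMatrix_eq hQR.1
  rw [← hVN] at hQR
  refine ⟨N, VN, hN.trans ?_, happrox VN hQR, hQR, ?_, ?_,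
    fun hεE hε2 => time_factorProgram_le_maximalEnergy hε hεE hε2 hN _, ?_, ?_⟩
  · gcongr
    norm_num
  · rw [hVN]
    exact (runs_factorProgram_one _).1
  · refine (time_factorProgram_le hE hε _).trans ?_
    exact mul_le_mul_of_nonneg_right (by norm_num) (by positivity)
  · rw [hVN]
    exact (runs_entriesProgram _).1
  · refine (time_entriesProgram_le hE hε _).trans ?_
    exact mul_le_mul_of_nonneg_right (by norm_num) (by positivity)

theorem theorem1 :
    ∃ (C : ℝ) (P P' : Program), 0 < C ∧
      ∀ U : FockSpace ≃ₗᵢ[ℂ] FockSpace, IsPhysical U →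
      ∀ E ε : ℝ, 0 ≤ E → 0 < ε →
        maximalEnergy U (64 * E / ε ^ 2) < ⊤ ∧
        ∃ (N : ℕ) (VN : fockSubspace N ≃ₗᵢ[ℂ] fockSubspace N),
          -- the effective dimension
          (N : ℝ≥0∞) ≤
            ENNReal.ofReal (C * (max E (ε ^ 2) / ε ^ 4)) * maximalEnergy U (64 * E / ε ^ 2) ∧
          -- the approximation, for every completion
          (∀ V' : (fockSubspace N)ᗮ ≃ₗᵢ[ℂ] (fockSubspace N)ᗮ,
            ecDiamondNorm E
              (ampliatedChannel (toOperator U) - ampliatedChannel (directSum VN V'))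
              ≤ ENNReal.ofReal ε) ∧
          -- `VN` is the unitary QR factor of the truncated matrix
          IsQRFactor (fockMatrix VN) (truncation U N ⌊64 * E / ε ^ 2⌋₊) ∧
          -- `P` computes `VN` in factored form
          (P.output (truncation U N ⌊64 * E / ε ^ 2⌋₊)).outputReflectors (N + 1)
            (⌊64 * E / ε ^ 2⌋₊ + 1) = fockMatrix VN ∧
          (P.time (truncation U N ⌊64 * E / ε ^ 2⌋₊) : ℝ) ≤
            C * ((N + 1) * (max E (ε ^ 2)) ^ 2 / ε ^ 4) ∧
          (ε ^ 2 ≤ E → ε ≤ 2 →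
            (P.time (truncation U N ⌊64 * E / ε ^ 2⌋₊) : ℝ≥0∞) ≤
              ENNReal.ofReal (C * (E ^ 3 / ε ^ 8)) * maximalEnergy U (64 * E / ε ^ 2)) ∧
          -- `P'` computes all the entries of `VN`
          (P'.output (truncation U N ⌊64 * E / ε ^ 2⌋₊)).outputMatrix (N + 1) = fockMatrix VN ∧
          (P'.time (truncation U N ⌊64 * E / ε ^ 2⌋₊) : ℝ) ≤
            C * ((N + 1) ^ 2 * (max E (ε ^ 2) / ε ^ 2)) := by
  obtain ⟨C, P, P', hC, h⟩ := theorem1_general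
  exact ⟨C, P, P', hC, fun U hU E ε hE hε => ⟨hU.maximalEnergy_lt_top _, h U E ε hE hε⟩⟩
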